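/- For a prime $p$ put $\gamma_p(z)=(1-p^{-z})^{-1}$, put $\gamma_\infty(z)=\pi^{-z/2}\Gamma(z/2)$, and for each place $v$ of $\mathbb Q$ let $\rho_v(z)=\gamma_v(z)/\gamma_v(1-z)$. Let $\mathbb C_-=\{z\in\mathbb C : \Re z<\tfrac12\}$, whose boundary is the critical line $\Re z=\tfrac12$ with Lebesgue measure, and let $\mathcal P$ be the orthogonal projection of $L^2(\partial\mathbb C_-)$ onto the Hardy space $H^2(\mathbb C_-)$ (the boundary values of the holomorphic functions on $\mathbb C_-$ whose $L^2$-norms on vertical lines are bounded). For $u\in L^\infty(\partial\mathbb C_-)$, acting on $L^2(\partial\mathbb C_-)$ by multiplication, the Sonin space $S(u)$ is the kernel of $u_{22}=(1-\mathcal P)\,u\,(1-\mathcal P)$ regarded as an operator on the range of $1-\mathcal P$, that is, $$S(u)=\{\xi\in(1-\mathcal P)L^2(\partial\mathbb C_-) : (1-\mathcal P)(u\xi)=0\}.$$ For a finite set $F$ of places of $\mathbb Q$ containing $\infty$, let $u(F)=\prod_{v\in F}\rho_v$, a function of modulus $1$ on the critical line. (i) For every finite set $F$ of places of $\mathbb Q$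 containing $\infty$, the Sonin space $S(u(F))$ is infinite dimensional (over $\mathbb C$). (ii) Let $F\subset F'$ be finite sets of places of $\mathbb Q$ containing $\infty$. Multiplication by $D(F,F')(z)=\prod_{p\in F'\setminus F}(1-p^{-z})$ defines an injective linear map $S(u(F))\to S(u(F'))$. Consequently the spaces $S(u(F))$ form a filtering inductive system under these maps: the finite sets of places containing $\infty$ are directed by inclusion, the map for $F=F'$ is the identity, and for $F\subset F'\subset F''$ the map $S(u(F))\to S(u(F''))$ is the composite of $S(u(F))\to S(u(F'))$ and $S(u(F'))\to S(u(F''))$. -/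

import Mathlib

open MeasureTheory Filter Topology
open scoped ENNReal

noncomputable section

namespace SemilocalSonin

/-- The places of `ℚ`: `none` is the archimedean place `∞`, `some p` is the prime `p`. -/
abbrev Place : Type := Option Nat.Primes

/-- The finite sets of places of `ℚ` that contain the archimedean place, ordered by inclusion. -/
abbrev FinPlaces : Type := {F : Finset Place // none ∈ F}

/-- The local factors `γ_∞(z) = π^{-z/2} Γ(z/2)` and `γ_p(z) = (1 - p^{-z})⁻¹`. -/
def localFactor : Place → ℂ → ℂ
  | none, z => (Real.pi : ℂ) ^ (-z / 2) * Complex.Gamma (z / 2)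
  | some p, z => (1 - ((p : ℕ) : ℂ) ^ (-z))⁻¹

/-- The ratio of local factors `ρ_v(z) = γ_v(z) / γ_v(1 - z)`. -/
def rho (v : Place) (z : ℂ) : ℂ := localFactor v z / localFactor v (1 - z)

/-- The product `u(F) = ∏_{v ∈ F} ρ_v`. -/
def uProd (F : Finset Place) (z : ℂ) : ℂ := ∏ v ∈ F, rho v z

/-- `D(F,F')(z) = ∏_p (1 - p^{-z})`, over the primes `p` in `F' \ F`. -/
def dProd (F F' : Finset Place) (z : ℂ) : ℂ :=
  ∏ p ∈ Finset.eraseNone (F' \ F), (1 - ((p : ℕ) : ℂ) ^ (-z))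

/-- The point `x + i s`; for fixed `x`, it parametrizes the vertical line `Re z = x`. -/
def vert (x s : ℝ) : ℂ := (x : ℂ) + (s : ℂ) * Complex.I

/-- The point `1/2 + i s` of the critical line, the boundary of `ℂ₋ = {Re z < 1/2}`. -/
def crit (s : ℝ) : ℂ := vert (1 / 2) s

/-- `L²(∂ℂ₋)`, the critical line being identified with `ℝ` through `s ↦ 1/2 + i s`. -/
abbrev L2 : Type := Lp ℂ 2 (volume : Measure ℝ)

/-- `f` is holomorphic in the half plane `Re z < 1/2`, its `L²` norms on vertical lines are
uniformly bounded, and `ξ` is its boundary value on the critical line (as a limit in `L²`). -/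
structure IsHardyExtension (f : ℂ → ℂ) (ξ : L2) : Prop where
  holo : DifferentiableOn ℂ f {z : ℂ | z.re < 1 / 2}
  bdd : ∃ C : ℝ≥0∞, C < ∞ ∧
    ∀ x : ℝ, x < 1 / 2 → eLpNorm (fun s : ℝ => f (vert x s)) 2 volume ≤ C
  boundary : Tendsto (fun x : ℝ => eLpNorm (fun s : ℝ => f (vert x s) - ξ s) 2 volume)
    (𝓝[<] (1 / 2 : ℝ)) (𝓝 0)

theorem continuous_vert (x : ℝ) : Continuous (vert x) := by
  unfold vert; fun_prop

theorem IsHardyExtension.aesm {f : ℂ → ℂ} {ξ : L2} (h : IsHardyExtension f ξ) {x : ℝ}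
    (hx : x < 1 / 2) : AEStronglyMeasurable (fun s : ℝ => f (vert x s)) volume := by
  refine Continuous.aestronglyMeasurable ?_
  refine h.holo.continuousOn.comp_continuous (continuous_vert x) ?_
  intro s
  simpa [vert] using hx

/-- The Hardy space `H²(ℂ₋)` as a space of boundary values inside `L²(∂ℂ₋)`. -/
def hardy : Submodule ℂ L2 where
  carrier := {ξ | ∃ f : ℂ → ℂ, IsHardyExtension f ξ}
  zero_mem' := by
    refine ⟨0, differentiableOn_const 0, ⟨0, by simp, by simp⟩, ?_⟩
    have : ∀ x : ℝ, eLpNorm (fun s : ℝ => (0 : ℂ → ℂ) (vert x s) - (0 : L2) s) 2 volume = 0 := by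
      intro x
      rw [← eLpNorm_zero (α := ℝ) (ε := ℂ) (p := 2) (μ := volume)]
      refine eLpNorm_congr_ae ?_
      filter_upwards [Lp.coeFn_zero ℂ 2 (volume : Measure ℝ)] with s hs
      simp [hs]
    simp only [this]
    exact tendsto_const_nhds
  add_mem' := by
    rintro ξ η ⟨f, hf⟩ ⟨g, hg⟩
    obtain ⟨C, hC, hfC⟩ := hf.bdd
    obtain ⟨D, hD, hgD⟩ := hg.bdd
    refine ⟨f + g, hf.holo.add hg.holo, ⟨C + D, ENNReal.add_lt_top.2 ⟨hC, hD⟩, ?_⟩, ?_⟩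
    · intro x hx
      exact (eLpNorm_add_le (hf.aesm hx) (hg.aesm hx) (by norm_num)).trans
        (add_le_add (hfC x hx) (hgD x hx))
    · have hlim := hf.boundary.add hg.boundary
      rw [add_zero] at hlim
      refine tendsto_of_tendsto_of_tendsto_of_le_of_le' tendsto_const_nhds hlim
        (Eventually.of_forall fun _ => zero_le) ?_
      filter_upwards [self_mem_nhdsWithin] with x hx
      refine le_trans (le_of_eq ?_) (eLpNorm_add_le
        ((hf.aesm hx).sub (Lp.aestronglyMeasurable ξ))
        ((hg.aesm hx).sub (Lp.aestronglyMeasurable η)) (by norm_num))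
      refine eLpNorm_congr_ae ?_
      filter_upwards [Lp.coeFn_add ξ η] with s hs
      simp only [hs, Pi.add_apply]
      ring
  smul_mem' := by
    rintro c ξ ⟨f, hf⟩
    obtain ⟨C, hC, hfC⟩ := hf.bdd
    refine ⟨c • f, hf.holo.const_smul c, ⟨‖c‖ₑ * C, ENNReal.mul_lt_top (by simp) hC, ?_⟩, ?_⟩
    · intro x hx
      have : eLpNorm (c • fun s : ℝ => f (vert x s)) 2 volume ≤ ‖c‖ₑ * C := by
        rw [eLpNorm_const_smul]
        gcongr
        exact hfC x hx
      exact this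
    · have hlim := ENNReal.Tendsto.const_mul (a := ‖c‖ₑ) hf.boundary (Or.inr (by simp))
      rw [mul_zero] at hlim
      refine hlim.congr fun x => ?_
      rw [← eLpNorm_const_smul]
      refine eLpNorm_congr_ae ?_
      filter_upwards [Lp.coeFn_smul c ξ] with s hs
      simp only [hs, Pi.smul_apply, smul_eq_mul]
      ring

/-- The orthogonal projection `P` of `L²(∂ℂ₋)` on `H²(ℂ₋)`. (The Hardy space is closed; the
closure is written only because orthogonal projections are defined for closed subspaces.) -/
def hardyProj : L2 →L[ℂ] L2 := hardy.topologicalClosure.starProjection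

/-- Multiplication by `u ∈ L^∞(∂ℂ₋)`, as a bounded operator on `L²(∂ℂ₋)`. -/
def mulOp (u : Lp ℂ ∞ (volume : Measure ℝ)) : L2 →L[ℂ] L2 :=
  (ContinuousLinearMap.mul ℂ ℂ).holderL volume ∞ 2 2 u

/-- The operator `(1 - P) u (1 - P)`. -/
def op22 (u : Lp ℂ ∞ (volume : Measure ℝ)) : L2 →L[ℂ] L2 :=
  (1 - hardyProj) ∘L mulOp u ∘L (1 - hardyProj)

/-- The Sonin space `S(u)`: the kernel of the matrix entry `u₂₂ = (1 - P) u (1 - P)`, an operator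
on the range of `1 - P`. -/
def sonin (u : Lp ℂ ∞ (volume : Measure ℝ)) : Submodule ℂ L2 :=
  LinearMap.range (1 - hardyProj : L2 →L[ℂ] L2).toLinearMap ⊓ LinearMap.ker (op22 u).toLinearMap

theorem one_sub_crit (s : ℝ) : 1 - crit s = (starRingEnd ℂ) (crit s) := by
  apply Complex.ext
  · simp [crit, vert]; norm_num
  · simp [crit, vert]

theorem localFactor_conj (v : Place) (z : ℂ) :
    localFactor v ((starRingEnd ℂ) z) = (starRingEnd ℂ) (localFactor v z) := by
  rcases v with _ | p
  · have h := Complex.cpow_conj (Real.pi : ℂ) (-z / 2)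
      (by rw [Complex.arg_ofReal_of_nonneg Real.pi_pos.le]; exact Real.pi_pos.ne)
    have h2 := Complex.Gamma_conj (z / 2)
    simp only [map_div₀, map_neg, Complex.conj_ofNat, Complex.conj_ofReal] at h h2
    simp only [localFactor, map_mul, h, h2]
  · have h := Complex.cpow_conj ((p : ℕ) : ℂ) (-z)
      (by rw [Complex.natCast_arg]; exact Real.pi_pos.ne)
    simp only [map_neg, Complex.conj_natCast] at h
    simp only [localFactor, map_inv₀, map_sub, map_one, h]

theorem norm_rho_crit_le (v : Place) (s : ℝ) : ‖rho v (crit s)‖ ≤ 1 := by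
  rw [rho, one_sub_crit, localFactor_conj, norm_div, RCLike.norm_conj]
  exact div_self_le_one _

theorem measurable_localFactor (v : Place) : Measurable (localFactor v) := by
  rcases v with _ | p
  · have h := Complex.differentiable_Gammaℝ_inv.continuous.measurable.inv
    have e : localFactor none = fun z : ℂ => ((Complex.Gammaℝ z)⁻¹)⁻¹ := by
      funext z
      rw [inv_inv]
      rfl
    rw [e]
    exact h
  · have hp : ((p : ℕ) : ℂ) ≠ 0 := by exact_mod_cast p.2.ne_zero
    have : Continuous fun z : ℂ => 1 - ((p : ℕ) : ℂ) ^ (-z) :=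
      continuous_const.sub (continuous_neg.const_cpow (Or.inl hp))
    exact this.measurable.inv

theorem memLp_uProd (F : Finset Place) :
    MemLp (fun s : ℝ => uProd F (crit s)) ∞ (volume : Measure ℝ) := by
  have hc : Measurable crit := (continuous_vert (1 / 2)).measurable
  have hm : Measurable fun s : ℝ => uProd F (crit s) := by
    unfold uProd rho
    refine Finset.measurable_fun_prod _ fun v _ => ?_
    exact ((measurable_localFactor v).comp hc).div
      ((measurable_localFactor v).comp (measurable_const.sub hc))
  refine memLp_top_of_bound hm.aestronglyMeasurable 1 (Eventually.of_forall fun s => ?_)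
  rw [uProd, norm_prod]
  exact Finset.prod_le_one (fun v _ => norm_nonneg _) fun v _ => norm_rho_crit_le v s

/-- The restriction of `u(F)` to the critical line, as an element of `L^∞(∂ℂ₋)`. -/
def uF (F : Finset Place) : Lp ℂ ∞ (volume : Measure ℝ) := (memLp_uProd F).toLp _

end SemilocalSonin

end

open SemilocalSonin

open MeasureTheory Filter Topology
open scoped ENNReal

noncomputable section

namespace SemilocalSonin

/-! A vector lies in `sonin u` iff it is orthogonal to `hardy` and `u` sends it into the closure of
`hardy` (`mem_sonin_iff`).

Maps. On the critical line the conjugate of `D(z)` is `D(1 - z)`, which is bounded and holomorphic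
on the left half plane and hence preserves the Hardy space. So its adjoint, multiplication by `D`,
preserves the orthogonal complement. Since `u(F') D(z) = D(1 - z) u(F)` (`uProd_mul_dProd`), `D`
maps Sonin vectors to Sonin vectors; it has no zero on the line, which gives injectivity.

Infinite dimension. By these injections it suffices to treat `F = {∞}`. The functional equation
reads `ρ_∞(z) cosZeta a z = hurwitzZetaEven a (1 - z)`. A third difference in `a` at suitable nodes
in `[2/5, 1/2]` makes the cosine series start at `n = 3`, so it is `O(|z| 3^(-Re z))` on the right,
while the Hurwitz side at `1 - z` is `O(|1 - z| (5/2)^(1 - Re z))` on the left. Because `5/2 < e <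
3`, multiplication by `exp z` and a factor of small exponential type (`weight`) makes the first
decay for `Re z ≥ 1/2` and the second for `Re z ≤ 1/2`. The product is then orthogonal to the Hardy
space by contour shifting (`mem_hardy_orthogonal`), and `ρ_∞` times it is in the Hardy space
(`toLp_soninFun_mem_sonin`). Extra factors `z ^ i` with `i ≤ n` give `n + 1` independent vectors for
every `n`. -/

/-! ### Multipliers of the Hardy space. -/

/-- Dominated convergence in `L²`, for functions tending to zero. -/
theorem tendsto_eLpNorm_two_zero {ι : Type*} {l : Filter ι} [l.IsCountablyGenerated]
    {F : ι → ℝ → ℂ} {b : ℝ → ℂ} (hF : ∀ᶠ i in l, AEStronglyMeasurable (F i) volume)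
    (hb : MemLp b 2 volume) (hle : ∀ᶠ i in l, ∀ᵐ s : ℝ, ‖F i s‖ ≤ ‖b s‖)
    (hlim : ∀ᵐ s : ℝ, Tendsto (fun i => F i s) l (𝓝 0)) :
    Tendsto (fun i => eLpNorm (F i) 2 volume) l (𝓝 0) := by
  have key : Tendsto (fun i => ∫⁻ s, ‖F i s‖ₑ ^ (2 : ℝ)) l (𝓝 (∫⁻ _ : ℝ, 0)) := by
    refine tendsto_lintegral_filter_of_dominated_convergence' (fun s => ‖b s‖ₑ ^ (2 : ℝ))
      ?_ ?_ ?_ ?_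
    · filter_upwards [hF] with i hi using hi.enorm.pow_const _
    · filter_upwards [hle] with i hi
      filter_upwards [hi] with s hs
      gcongr
      exact enorm_le_iff_norm_le.2 hs
    · exact (lintegral_rpow_enorm_lt_top_of_eLpNorm_lt_top (by norm_num) (by norm_num) hb.2).ne
    · filter_upwards [hlim] with s hs
      have := (ENNReal.continuous_rpow_const (y := 2)).continuousAt.tendsto.comp hs.enorm
      simpa [Function.comp_def] using this
  have h2 := (ENNReal.continuous_rpow_const (y := 1 / 2)).continuousAt.tendsto.comp key
  simp only [lintegral_zero, Function.comp_def] at h2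
  rw [ENNReal.zero_rpow_of_pos (by norm_num)] at h2
  refine h2.congr fun i => ?_
  rw [eLpNorm_eq_lintegral_rpow_enorm_toReal (by norm_num) (by norm_num)]
  simp

theorem vert_re (x s : ℝ) : (vert x s).re = x := by simp [vert]

theorem vert_im (x s : ℝ) : (vert x s).im = s := by simp [vert]

theorem crit_re (s : ℝ) : (crit s).re = 1 / 2 := vert_re _ _

theorem continuous_crit : Continuous crit := continuous_vert _

theorem tendsto_vert_crit (s : ℝ) :
    Tendsto (fun x : ℝ => vert x s) (𝓝[<] (1 / 2 : ℝ)) (𝓝 (crit s)) := by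
  have : Continuous fun x : ℝ => vert x s := by unfold vert; fun_prop
  exact this.continuousAt.tendsto.mono_left nhdsWithin_le_nhds

/-- Multiplication by a function that is entire and bounded on `Re z ≤ 1/2` preserves the Hardy
space. -/
theorem mem_hardy_of_mul {m : ℂ → ℂ} (hm : Differentiable ℂ m) {B : ℝ}
    (hB : ∀ z : ℂ, z.re ≤ 1 / 2 → ‖m z‖ ≤ B) {ξ η : L2} (hξ : ξ ∈ hardy)
    (hη : η =ᵐ[volume] fun s => m (crit s) * ξ s) : η ∈ hardy := by
  obtain ⟨f, hf⟩ := hξ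
  obtain ⟨C, hC, hfC⟩ := hf.bdd
  have hB0 : 0 ≤ B := (norm_nonneg _).trans (hB 0 (by norm_num))
  have hmul : ∀ x : ℝ, x ≤ 1 / 2 → ∀ g : ℝ → ℂ,
      eLpNorm (fun s => m (vert x s) * g s) 2 volume ≤ ENNReal.ofReal B * eLpNorm g 2 volume := by
    intro x hx g
    refine eLpNorm_le_mul_eLpNorm_of_ae_le_mul (Eventually.of_forall fun s => ?_) 2
    rw [norm_mul]
    gcongr
    exact hB _ (by rw [vert_re]; exact hx)
  have hmx : ∀ x, AEStronglyMeasurable (fun s => m (vert x s)) volume := fun x =>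
    (hm.continuous.comp (continuous_vert x)).aestronglyMeasurable
  have hmc : AEStronglyMeasurable (fun s => m (crit s)) volume := hmx _
  refine ⟨fun z => m z * f z, hm.differentiableOn.mul hf.holo,
    ⟨ENNReal.ofReal B * C, ENNReal.mul_lt_top (by simp) hC, fun x hx => ?_⟩, ?_⟩
  · refine (hmul x hx.le (fun s => f (vert x s))).trans ?_
    gcongr
    exact hfC x hx
  -- With `m₀` the boundary value of `m`, write `m f - m₀ ξ = m (f - ξ) + (m - m₀) ξ`: the bound `B`
  -- controls the first term, dominated convergence the second.
  · have h1 : Tendsto (fun x : ℝ => eLpNorm (fun s => (m (vert x s) - m (crit s)) * ξ s) 2 volume)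
        (𝓝[<] (1 / 2 : ℝ)) (𝓝 0) := by
      refine tendsto_eLpNorm_two_zero (b := fun s => ((2 * B : ℝ) : ℂ) * ξ s)
        (Eventually.of_forall fun x => ((hmx x).sub hmc).mul (Lp.aestronglyMeasurable ξ))
        ((Lp.memLp ξ).const_mul _) ?_ (Eventually.of_forall fun s => ?_)
      · filter_upwards [self_mem_nhdsWithin] with x hx
        refine Eventually.of_forall fun s => ?_
        rw [norm_mul, norm_mul, Complex.norm_real, Real.norm_of_nonneg (by positivity)]
        gcongr
        refine (norm_sub_le _ _).trans ?_
        have h1 := hB (vert x s) (by rw [vert_re]; exact le_of_lt hx)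
        have h2 := hB (crit s) (crit_re s).le
        linarith
      · have h := ((hm.continuous.tendsto (crit s)).comp (tendsto_vert_crit s)).sub_const
          (m (crit s))
        simpa using h.mul_const (ξ s)
    have h2 := ENNReal.Tendsto.const_mul (a := ENNReal.ofReal B) hf.boundary (Or.inr (by simp))
    rw [mul_zero] at h2
    have h3 := h2.add h1
    rw [add_zero] at h3
    refine tendsto_of_tendsto_of_tendsto_of_le_of_le' tendsto_const_nhds h3
      (Eventually.of_forall fun _ => zero_le) ?_
    filter_upwards [self_mem_nhdsWithin] with x hx
    refine le_trans ?_ (add_le_add_left (hmul x (le_of_lt hx) fun s => f (vert x s) - ξ s) _)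
    refine le_trans (le_of_eq ?_) (eLpNorm_add_le
        ((hmx x).mul ((hf.aesm hx).sub (Lp.aestronglyMeasurable ξ)))
        (((hmx x).sub hmc).mul (Lp.aestronglyMeasurable ξ)) (by norm_num))
    refine eLpNorm_congr_ae ?_
    filter_upwards [hη] with s hs
    simp only [hs, Pi.add_apply]
    ring

/-! ### Multiplication operators and the Sonin condition. -/

theorem mulOp_apply (u : Lp ℂ ∞ (volume : Measure ℝ)) (ξ : L2) :
    mulOp u ξ =ᵐ[volume] fun s => u s * ξ s := by
  filter_upwards [(ContinuousLinearMap.mul ℂ ℂ).coeFn_holder (r := 2) u ξ] with s hs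
  exact hs

theorem mulOp_toLp {φ : ℝ → ℂ} (hφ : MemLp φ ∞ (volume : Measure ℝ)) (ξ : L2) :
    mulOp (hφ.toLp φ) ξ =ᵐ[volume] fun s => φ s * ξ s := by
  filter_upwards [mulOp_apply (hφ.toLp φ) ξ, hφ.coeFn_toLp] with s h1 h2
  rw [h1, h2]

/-- The Sonin space consists of the vectors orthogonal to the Hardy space that multiplication
by `u` sends into the (closed) Hardy space. -/
theorem mem_sonin_iff (u : Lp ℂ ∞ (volume : Measure ℝ)) (ξ : L2) :
    ξ ∈ sonin u ↔ ξ ∈ hardyᗮ ∧ mulOp u ξ ∈ hardy.topologicalClosure := by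
  have hP : (1 - hardyProj : L2 →L[ℂ] L2) = (hardy.topologicalClosure)ᗮ.starProjection :=
    (Submodule.starProjection_orthogonal' _).symm
  have hcl : (hardy.topologicalClosure)ᗮ = hardyᗮ := hardy.orthogonal_closure
  have hrange : ξ ∈ LinearMap.range (1 - hardyProj : L2 →L[ℂ] L2).toLinearMap ↔ ξ ∈ hardyᗮ := by
    rw [hP, ← hcl]
    exact iff_of_eq (congrArg (ξ ∈ ·) (Submodule.range_starProjection _))
  rw [sonin, Submodule.mem_inf, hrange, and_congr_right_iff]
  intro hξ
  rw [LinearMap.mem_ker]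
  have h1 : (1 - hardyProj : L2 →L[ℂ] L2) ξ = ξ := by
    rw [hP]
    exact Submodule.starProjection_eq_self_iff.2 (hcl ▸ hξ)
  have h2 : op22 u ξ = (1 - hardyProj : L2 →L[ℂ] L2) (mulOp u ξ) := by
    rw [op22, ContinuousLinearMap.comp_apply, ContinuousLinearMap.comp_apply, h1]
  change op22 u ξ = 0 ↔ _
  rw [h2, hP, Submodule.starProjection_apply_eq_zero_iff, Submodule.orthogonal_orthogonal]

/-! ### The Euler factors `D(F,F')` and the inductive system. -/

theorem norm_prime_cpow (p : Nat.Primes) (z : ℂ) :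
    ‖((p : ℕ) : ℂ) ^ z‖ = ((p : ℕ) : ℝ) ^ z.re := by
  rw [Complex.norm_natCast_cpow_of_pos p.2.pos]

theorem differentiable_dProd (F F' : Finset Place) : Differentiable ℂ (dProd F F') := by
  unfold dProd
  refine Differentiable.fun_finsetProd fun p _ => ?_
  refine (differentiable_const _).sub (Differentiable.const_cpow differentiable_neg (Or.inl ?_))
  exact_mod_cast p.2.ne_zero

theorem norm_dProd_le (F F' : Finset Place) {z : ℂ} (hz : 0 ≤ z.re) :
    ‖dProd F F' z‖ ≤ ∏ _p ∈ Finset.eraseNone (F' \ F), 2 := by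
  rw [dProd, norm_prod]
  refine Finset.prod_le_prod (fun p _ => norm_nonneg _) fun p _ => ?_
  refine (norm_sub_le _ _).trans ?_
  rw [norm_one, norm_prime_cpow, Complex.neg_re]
  have := Real.rpow_le_one_of_one_le_of_nonpos (x := ((p : ℕ) : ℝ)) (z := -z.re)
    (by exact_mod_cast p.2.one_lt.le) (by linarith)
  linarith

theorem one_sub_prime_cpow_ne_zero (p : Nat.Primes) {z : ℂ} (hz : 0 < z.re) :
    1 - ((p : ℕ) : ℂ) ^ (-z) ≠ 0 := by
  intro h
  have h1 : ‖((p : ℕ) : ℂ) ^ (-z)‖ = 1 := by rw [← sub_eq_zero.1 h, norm_one]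
  rw [norm_prime_cpow, Complex.neg_re] at h1
  have := Real.rpow_lt_one_of_one_lt_of_neg (x := ((p : ℕ) : ℝ)) (z := -z.re)
    (by exact_mod_cast p.2.one_lt) (by linarith)
  linarith

theorem dProd_ne_zero (F F' : Finset Place) {z : ℂ} (hz : 0 < z.re) : dProd F F' z ≠ 0 :=
  Finset.prod_ne_zero_iff.2 fun p _ => one_sub_prime_cpow_ne_zero p hz

theorem dProd_one_sub_crit (F F' : Finset Place) (s : ℝ) :
    dProd F F' (1 - crit s) = (starRingEnd ℂ) (dProd F F' (crit s)) := by
  rw [one_sub_crit, dProd, dProd, map_prod]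
  refine Finset.prod_congr rfl fun p _ => ?_
  have h := localFactor_conj (some p) (crit s)
  simp only [localFactor, map_inv₀] at h
  exact inv_injective h

theorem memLp_dProd (F F' : Finset Place) :
    MemLp (fun s : ℝ => dProd F F' (crit s)) ∞ (volume : Measure ℝ) :=
  memLp_top_of_bound
    ((differentiable_dProd F F').continuous.comp continuous_crit).aestronglyMeasurable _
    (Eventually.of_forall fun s => norm_dProd_le F F' (by rw [crit_re]; norm_num))

theorem memLp_dProd_one_sub (F F' : Finset Place) :
    MemLp (fun s : ℝ => dProd F F' (1 - crit s)) ∞ (volume : Measure ℝ) := by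
  simp only [dProd_one_sub_crit]
  exact (memLp_dProd F F').star

/-- Multiplication by `D(F,F')` on `L²(∂ℂ₋)`. -/
def dOp (F F' : Finset Place) : L2 →L[ℂ] L2 := mulOp ((memLp_dProd F F').toLp _)

theorem dOp_apply (F F' : Finset Place) (ξ : L2) :
    dOp F F' ξ =ᵐ[volume] fun s => dProd F F' (crit s) * ξ s := mulOp_toLp _ ξ

/-- Multiplication by `z ↦ D(F,F')(1 - z)`, the adjoint of `dOp`. -/
def dOpAdj (F F' : Finset Place) : L2 →L[ℂ] L2 := mulOp ((memLp_dProd_one_sub F F').toLp _)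

theorem dOpAdj_apply (F F' : Finset Place) (ξ : L2) :
    dOpAdj F F' ξ =ᵐ[volume] fun s => dProd F F' (1 - crit s) * ξ s := mulOp_toLp _ ξ

theorem inner_dOp (F F' : Finset Place) (ξ η : L2) :
    inner ℂ η (dOp F F' ξ) = inner ℂ (dOpAdj F F' η) ξ := by
  rw [L2.inner_def, L2.inner_def]
  refine integral_congr_ae ?_
  filter_upwards [dOp_apply F F' ξ, dOpAdj_apply F F' η] with s h1 h2
  rw [h1, h2, dProd_one_sub_crit]
  simp only [RCLike.inner_apply, map_mul, Complex.conj_conj]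
  ring

theorem dOpAdj_mem_hardy (F F' : Finset Place) {ξ : L2} (hξ : ξ ∈ hardy) :
    dOpAdj F F' ξ ∈ hardy :=
  mem_hardy_of_mul (m := fun z => dProd F F' (1 - z))
    ((differentiable_dProd F F').comp ((differentiable_const _).sub differentiable_id))
    (fun z hz => norm_dProd_le F F' (by simp; linarith)) hξ (dOpAdj_apply F F' ξ)

theorem uF_apply (F : Finset Place) (ξ : L2) :
    mulOp (uF F) ξ =ᵐ[volume] fun s => uProd F (crit s) * ξ s := mulOp_toLp _ ξ

theorem dProd_eq_prod (F F' : FinPlaces) (z : ℂ) :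
    dProd F.1 F'.1 z = ∏ v ∈ F'.1 \ F.1, (localFactor v z)⁻¹ := by
  have hnone : none ∉ F'.1 \ F.1 := by simp [F.2]
  have hmap : (Finset.eraseNone (F'.1 \ F.1)).map Function.Embedding.some = F'.1 \ F.1 := by
    rw [Finset.map_some_eraseNone, Finset.erase_eq_of_notMem hnone]
  rw [dProd, ← hmap, Finset.prod_map, hmap]
  simp [localFactor]

/-- Prime by prime this is `ρ_p(z) γ_p(z)⁻¹ = γ_p(1 - z)⁻¹`, valid on the line because `1 - p^(-z)`
has no zero there. -/
theorem uProd_mul_dProd {F F' : FinPlaces} (h : F ≤ F') (s : ℝ) :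
    uProd F'.1 (crit s) * dProd F.1 F'.1 (crit s) =
      dProd F.1 F'.1 (1 - crit s) * uProd F.1 (crit s) := by
  have h1 : uProd F'.1 (crit s) = (∏ v ∈ F'.1 \ F.1, rho v (crit s)) * uProd F.1 (crit s) :=
    (Finset.prod_sdiff h).symm
  rw [h1, dProd_eq_prod, dProd_eq_prod, mul_right_comm, ← Finset.prod_mul_distrib]
  congr 1
  refine Finset.prod_congr rfl fun v hv => ?_
  have hv' : localFactor v (crit s) ≠ 0 := by
    rcases v with _ | p
    · simp [F.2] at hv
    · exact inv_ne_zero (one_sub_prime_cpow_ne_zero p (by rw [crit_re]; norm_num))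
  rw [rho]
  field_simp

theorem dOp_mem_sonin {F F' : FinPlaces} (h : F ≤ F') {ξ : L2} (hξ : ξ ∈ sonin (uF F.1)) :
    dOp F.1 F'.1 ξ ∈ sonin (uF F'.1) := by
  rw [mem_sonin_iff] at hξ ⊢
  refine ⟨(Submodule.mem_orthogonal _ _).2 fun η hη => ?_, ?_⟩
  · rw [inner_dOp]
    exact (Submodule.mem_orthogonal _ _).1 hξ.1 _ (dOpAdj_mem_hardy _ _ hη)
  · have he : mulOp (uF F'.1) (dOp F.1 F'.1 ξ) = dOpAdj F.1 F'.1 (mulOp (uF F.1) ξ) := by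
      refine Lp.ext ?_
      filter_upwards [uF_apply F'.1 (dOp F.1 F'.1 ξ), dOp_apply F.1 F'.1 ξ,
        dOpAdj_apply F.1 F'.1 (mulOp (uF F.1) ξ), uF_apply F.1 ξ] with s h1 h2 h3 h4
      rw [h1, h2, h3, h4, ← mul_assoc, ← mul_assoc, uProd_mul_dProd h]
    rw [he]
    exact map_mem_closure (dOpAdj F.1 F'.1).continuous hξ.2
      fun η hη => dOpAdj_mem_hardy _ _ hη

/-- Multiplication by `D(F,F')` as a map `S(u(F)) → S(u(F'))`. -/
def soninMap (F F' : FinPlaces) (h : F ≤ F') : sonin (uF F.1) →ₗ[ℂ] sonin (uF F'.1) :=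
  (dOp F.1 F'.1).toLinearMap.restrict fun _ hξ => dOp_mem_sonin h hξ

theorem soninMap_apply (F F' : FinPlaces) (h : F ≤ F') (ξ : sonin (uF F.1)) :
    ((soninMap F F' h ξ : L2) : ℝ → ℂ) =ᵐ[volume]
      fun s : ℝ => dProd F.1 F'.1 (crit s) * (ξ : L2) s := dOp_apply _ _ _

theorem soninMap_injective (F F' : FinPlaces) (h : F ≤ F') :
    Function.Injective (soninMap F F' h) := by
  intro ξ η he
  refine Subtype.ext (Lp.ext ?_)
  have h2 := soninMap_apply F F' h η
  rw [← he] at h2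
  filter_upwards [soninMap_apply F F' h ξ, h2] with s h1 h2
  exact mul_left_cancel₀ (dProd_ne_zero F.1 F'.1 (by rw [crit_re]; norm_num)) (h1.symm.trans h2)

theorem dProd_self (F : Finset Place) (z : ℂ) : dProd F F z = 1 := by simp [dProd]

theorem dProd_mul_dProd {F F' F'' : FinPlaces} (h : F ≤ F') (h' : F' ≤ F'') (z : ℂ) :
    dProd F'.1 F''.1 z * dProd F.1 F'.1 z = dProd F.1 F''.1 z := by
  rw [dProd_eq_prod, dProd_eq_prod, dProd_eq_prod, ← Finset.prod_union]
  · congr 1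
    ext v
    have h1 := @h v
    have h2 := @h' v
    simp only [Finset.mem_union, Finset.mem_sdiff]
    tauto
  · rw [Finset.disjoint_left]
    intro v h1 h2
    exact (Finset.mem_sdiff.1 h1).2 (Finset.mem_sdiff.1 h2).1

theorem directedSystem_soninMap :
    DirectedSystem (fun F : FinPlaces => sonin (uF F.1)) (fun F F' h => soninMap F F' h) where
  map_self F ξ := by
    refine Subtype.ext (Lp.ext ?_)
    filter_upwards [soninMap_apply F F le_rfl ξ] with s hs
    rw [hs, dProd_self, one_mul]
  map_map F₃ F₂ F₁ h h' ξ := by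
    refine Subtype.ext (Lp.ext ?_)
    filter_upwards [soninMap_apply F₂ F₃ h' (soninMap F₁ F₂ h ξ), soninMap_apply F₁ F₂ h ξ,
      soninMap_apply F₁ F₃ (h.trans h') ξ] with s h1 h2 h3
    rw [h1, h2, h3, ← mul_assoc, dProd_mul_dProd h h']

theorem isDirectedOrder_finPlaces : IsDirectedOrder FinPlaces where
  directed F F' := ⟨⟨F.1 ∪ F'.1, Finset.mem_union_left _ F.2⟩,
    Finset.subset_union_left, Finset.subset_union_right⟩

/-! ### Shifting vertical contours. -/

/-- The integral of a holomorphic function along vertical lines of the half plane `Re z < 1/2` is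
constant, if its `L¹` norms on these lines are bounded. -/
theorem integral_vert_eq {h : ℂ → ℂ} (hh : DifferentiableOn ℂ h {z : ℂ | z.re < 1 / 2})
    {C : ℝ≥0∞} (hC : C < ∞) (hbd : ∀ x : ℝ, x < 1 / 2 → eLpNorm (fun s => h (vert x s)) 1 volume ≤ C)
    {x₀ x₁ : ℝ} (h01 : x₀ ≤ x₁) (h1 : x₁ < 1 / 2) :
    ∫ s, h (vert x₀ s) = ∫ s, h (vert x₁ s) := by
  have hmeas : ∀ x : ℝ, x < 1 / 2 → AEStronglyMeasurable (fun s => h (vert x s)) volume := by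
    intro x hx
    refine Continuous.aestronglyMeasurable (hh.continuousOn.comp_continuous (continuous_vert x) ?_)
    intro s
    simpa [vert_re] using hx
  have hint : ∀ x : ℝ, x < 1 / 2 → Integrable (fun s => h (vert x s)) := fun x hx =>
    memLp_one_iff_integrable.1 ⟨hmeas x hx, (hbd x hx).trans_lt hC⟩
  -- By Fubini on the strip, the integral over the horizontal side at height `T` is an integrable
  -- function of `T`.
  have hprod : Integrable (fun q : ℝ × ℝ => h (vert q.1 q.2))
      ((volume.restrict (Set.Ioc x₀ x₁)).prod volume) := by
    have hm : AEStronglyMeasurable (fun q : ℝ × ℝ => h (vert q.1 q.2))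
        ((volume.restrict (Set.Ioc x₀ x₁)).prod volume) := by
      rw [Measure.restrict_prod_eq_prod_univ]
      refine ContinuousOn.aestronglyMeasurable ?_ (measurableSet_Ioc.prod MeasurableSet.univ)
      refine hh.continuousOn.comp (Continuous.continuousOn ?_) ?_
      · unfold vert
        fun_prop
      · intro q hq
        change (vert q.1 q.2).re < 1 / 2
        rw [vert_re]
        exact hq.1.2.trans_lt h1
    refine ⟨hm, ?_⟩
    rw [HasFiniteIntegral, lintegral_prod _ hm.enorm]
    have hle : ∫⁻ x in Set.Ioc x₀ x₁, ∫⁻ s, ‖h (vert x s)‖ₑ ≤ ∫⁻ _x in Set.Ioc x₀ x₁, C := by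
      refine setLIntegral_mono measurable_const fun x hx => ?_
      have := hbd x (hx.2.trans_lt h1)
      rwa [eLpNorm_one_eq_lintegral_enorm] at this
    refine hle.trans_lt ?_
    rw [setLIntegral_const]
    exact ENNReal.mul_lt_top hC (by simp)
  have hE : Integrable fun T : ℝ => ∫ x in x₀..x₁, h (vert x T) := by
    simp only [intervalIntegral.integral_of_le h01]
    exact hprod.integral_prod_right
  have hE2 := hE.comp_neg.sub hE
  have hrect : ∀ T : ℝ, (∫ x in x₀..x₁, h (vert x (-T))) - (∫ x in x₀..x₁, h (vert x T)) =
      -(Complex.I • ((∫ s in (-T)..T, h (vert x₁ s)) - ∫ s in (-T)..T, h (vert x₀ s))) := by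
    intro T
    have hr := Complex.integral_boundary_rect_eq_zero_of_differentiableOn h (vert x₀ (-T))
      (vert x₁ T) (hh.mono ?_)
    · simp only [vert_re, vert_im] at hr
      rw [smul_sub]
      simp only [vert] at hr ⊢
      linear_combination hr
    · rintro z ⟨hz, -⟩
      simp only [vert_re, Set.mem_preimage, Set.uIcc_of_le h01] at hz
      exact hz.2.trans_lt h1
  have hlim : Tendsto (fun T : ℝ => (∫ x in x₀..x₁, h (vert x (-T))) - ∫ x in x₀..x₁, h (vert x T))
      atTop (𝓝 (-(Complex.I • ((∫ s, h (vert x₁ s)) - ∫ s, h (vert x₀ s))))) := by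
    simp only [hrect]
    have ht : ∀ x : ℝ, x < 1 / 2 →
        Tendsto (fun T : ℝ => ∫ s in (-T)..T, h (vert x s)) atTop (𝓝 (∫ s, h (vert x s))) :=
      fun x hx => intervalIntegral_tendsto_integral (hint x hx) tendsto_neg_atTop_atBot tendsto_id
    exact (((ht x₁ h1).sub (ht x₀ (h01.trans_lt h1))).const_smul _).neg
  -- An integrable function of `T` that converges at infinity has limit zero, so no pointwise decay
  -- of `h` is needed.
  have h0 := (hE2.integrableAtFilter atTop).eq_zero_of_tendsto (fun s hs => ?_) hlim
  · rw [neg_eq_zero, smul_eq_zero] at h0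
    exact (sub_eq_zero.1 (h0.resolve_left Complex.I_ne_zero)).symm
  · obtain ⟨a, ha⟩ := mem_atTop_sets.1 hs
    exact top_unique (by rw [← Real.volume_Ici (a := a)]; exact measure_mono ha)

/-! ### Decaying entire functions and orthogonality to the Hardy space. -/

theorem memLp_two_inv_one_add_abs (K : ℝ) :
    MemLp (fun s : ℝ => ((K / (1 + |s|) : ℝ) : ℂ)) 2 volume := by
  have hc : Continuous fun s : ℝ => ((K / (1 + |s|) : ℝ) : ℂ) := by
    refine Complex.continuous_ofReal.comp (continuous_const.div (by fun_prop) fun s => ?_)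
    positivity
  rw [memLp_two_iff_integrable_sq_norm hc.aestronglyMeasurable]
  refine (integrable_inv_one_add_sq.const_mul (K ^ 2)).mono' (hc.norm.pow 2).aestronglyMeasurable
    (Eventually.of_forall fun s => ?_)
  rw [Complex.norm_real, norm_pow, norm_norm, Real.norm_eq_abs, sq_abs, div_pow, div_eq_mul_inv]
  gcongr
  nlinarith [abs_nonneg s, sq_abs s]

theorem eLpNorm_one_mul_le {f g : ℝ → ℂ} (hf : AEStronglyMeasurable f volume)
    (hg : AEStronglyMeasurable g volume) :
    eLpNorm (fun s => f s * g s) 1 volume ≤ eLpNorm f 2 volume * eLpNorm g 2 volume := by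
  have := eLpNorm_smul_le_mul_eLpNorm (p := 2) (q := 2) (r := 1) hg hf
  exact this

/-- An entire function with `‖k z‖ ≤ K / (1 + ‖z‖)` on the half plane `Re z ≤ 1/2`. -/
structure IsDecaying (k : ℂ → ℂ) (K : ℝ) : Prop where
  differentiable : Differentiable ℂ k
  bound : ∀ z : ℂ, z.re ≤ 1 / 2 → ‖k z‖ ≤ K / (1 + ‖z‖)

namespace IsDecaying

variable {k : ℂ → ℂ} {K : ℝ}

theorem nonneg (hk : IsDecaying k K) : 0 ≤ K := by
  have := (norm_nonneg _).trans (hk.bound 0 (by norm_num))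
  simpa using this

theorem norm_vert_le (hk : IsDecaying k K) {x : ℝ} (hx : x ≤ 1 / 2) (s : ℝ) :
    ‖k (vert x s)‖ ≤ ‖((K / (1 + |s|) : ℝ) : ℂ)‖ := by
  have hK := hk.nonneg
  rw [Complex.norm_real, Real.norm_of_nonneg (by positivity)]
  refine (hk.bound _ (by rw [vert_re]; exact hx)).trans ?_
  gcongr
  simpa [vert_im] using Complex.abs_im_le_norm (vert x s)

theorem aesm (hk : IsDecaying k K) (x : ℝ) :
    AEStronglyMeasurable (fun s => k (vert x s)) volume :=
  (hk.differentiable.continuous.comp (continuous_vert x)).aestronglyMeasurable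

theorem memLp_crit (hk : IsDecaying k K) : MemLp (fun s => k (crit s)) 2 volume :=
  (memLp_two_inv_one_add_abs K).mono (hk.aesm _)
    (Eventually.of_forall fun s => hk.norm_vert_le le_rfl s)

theorem tendsto_sub (hk : IsDecaying k K) :
    Tendsto (fun x : ℝ => eLpNorm (fun s => k (vert x s) - k (crit s)) 2 volume)
      (𝓝[<] (1 / 2 : ℝ)) (𝓝 0) := by
  refine tendsto_eLpNorm_two_zero (b := fun s : ℝ => ((K / (1 + |s|) : ℝ) : ℂ) * 2)
    (Eventually.of_forall fun x => (hk.aesm x).sub (hk.aesm _))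
    ((memLp_two_inv_one_add_abs K).mul_const 2) ?_ (Eventually.of_forall fun s => ?_)
  · filter_upwards [self_mem_nhdsWithin] with x hx
    refine Eventually.of_forall fun s => (norm_sub_le _ _).trans ?_
    have h1 := hk.norm_vert_le (le_of_lt hx) s
    have h2 := hk.norm_vert_le le_rfl s
    rw [norm_mul, Complex.norm_ofNat]
    change ‖k (crit s)‖ ≤ _ at h2
    linarith
  · have := ((hk.differentiable.continuous.tendsto (crit s)).comp
      (tendsto_vert_crit s)).sub_const (k (crit s))
    simpa using this

theorem eLpNorm_vert_le (hk : IsDecaying k K) {x : ℝ} (hx : x ≤ 1 / 2) :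
    eLpNorm (fun s => k (vert x s)) 2 volume ≤
      eLpNorm (fun s : ℝ => ((K / (1 + |s|) : ℝ) : ℂ)) 2 volume :=
  eLpNorm_mono fun s => hk.norm_vert_le hx s

theorem toLp_mem_hardy (hk : IsDecaying k K) : hk.memLp_crit.toLp _ ∈ hardy := by
  refine ⟨k, hk.differentiable.differentiableOn,
    ⟨_, (memLp_two_inv_one_add_abs K).2, fun x hx => hk.eLpNorm_vert_le hx.le⟩, ?_⟩
  refine hk.tendsto_sub.congr fun x => eLpNorm_congr_ae ?_
  filter_upwards [hk.memLp_crit.coeFn_toLp] with s hs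
  rw [hs]

theorem tendsto_atBot (hk : IsDecaying k K) :
    Tendsto (fun x : ℝ => eLpNorm (fun s => k (vert x s)) 2 volume) atBot (𝓝 0) := by
  refine tendsto_eLpNorm_two_zero (Eventually.of_forall fun x => hk.aesm x)
    (memLp_two_inv_one_add_abs K) ?_ (Eventually.of_forall fun s => ?_)
  · filter_upwards [eventually_le_atBot (1 / 2 : ℝ)] with x hx
    exact Eventually.of_forall fun s => hk.norm_vert_le hx s
  · have h1 : Tendsto (fun x : ℝ => K / (1 + |x|)) atBot (𝓝 0) :=
      tendsto_const_nhds.div_atTop (tendsto_atTop_add_const_left _ _ tendsto_abs_atBot_atTop)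
    refine squeeze_zero_norm' ?_ h1
    filter_upwards [eventually_le_atBot (1 / 2 : ℝ)] with x hx
    refine (hk.bound _ (by rw [vert_re]; exact hx)).trans ?_
    have hK := hk.nonneg
    gcongr
    simpa [vert_re] using Complex.abs_re_le_norm (vert x s)

/-- The integral of `k f` over a vertical line does not depend on the line, and by Cauchy–Schwarz it
tends to zero as the line moves to the left. Convergence in `L²` of both factors carries this to the
boundary. -/
theorem integral_mul_eq_zero (hk : IsDecaying k K) {η : L2} (hη : η ∈ hardy) :
    ∫ s, k (crit s) * η s = 0 := by
  obtain ⟨f, hf⟩ := hη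
  obtain ⟨C, hC, hfC⟩ := hf.bdd
  set B := eLpNorm (fun s : ℝ => ((K / (1 + |s|) : ℝ) : ℂ)) 2 volume with hB
  have hBfin : B < ∞ := (memLp_two_inv_one_add_abs K).2
  have hη2 := Lp.aestronglyMeasurable η
  have hbd : ∀ x : ℝ, x < 1 / 2 → eLpNorm (fun s => k (vert x s) * f (vert x s)) 1 volume ≤
      eLpNorm (fun s => k (vert x s)) 2 volume * C := fun x hx =>
    (eLpNorm_one_mul_le (hk.aesm x) (hf.aesm hx)).trans (by gcongr; exact hfC x hx)
  have hconst : ∀ x₀ x₁ : ℝ, x₀ ≤ x₁ → x₁ < 1 / 2 →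
      ∫ s, k (vert x₀ s) * f (vert x₀ s) = ∫ s, k (vert x₁ s) * f (vert x₁ s) := by
    intro x₀ x₁ h01 h1
    refine integral_vert_eq (h := fun z => k z * f z) (C := B * C)
      (hk.differentiable.differentiableOn.mul hf.holo) (ENNReal.mul_lt_top hBfin hC)
      (fun x hx => (hbd x hx).trans ?_) h01 h1
    gcongr
    exact hk.eLpNorm_vert_le hx.le
  have hzero : ∀ x : ℝ, x < 1 / 2 → ∫ s, k (vert x s) * f (vert x s) = 0 := by
    intro x hx
    have hlim : Tendsto (fun y : ℝ => eLpNorm (fun s => k (vert y s)) 2 volume * C) atBot (𝓝 0) := by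
      have := ENNReal.Tendsto.mul_const (b := C) hk.tendsto_atBot (Or.inr hC.ne)
      rwa [zero_mul] at this
    have hle : ‖∫ s, k (vert x s) * f (vert x s)‖ₑ ≤ 0 := by
      refine ge_of_tendsto hlim ?_
      filter_upwards [eventually_le_atBot x] with y hy
      rw [← hconst y x hy hx]
      refine (enorm_integral_le_lintegral_enorm _).trans ?_
      rw [← eLpNorm_one_eq_lintegral_enorm]
      exact hbd y (hy.trans_lt hx)
    simpa using hle
  have hIη : Integrable fun s => k (crit s) * η s :=
    memLp_one_iff_integrable.1 ⟨(hk.aesm _).mul hη2,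
      (eLpNorm_one_mul_le (hk.aesm _) hη2).trans_lt (ENNReal.mul_lt_top hk.memLp_crit.2
        (Lp.memLp η).2)⟩
  have hlim : Tendsto (fun x : ℝ => B * eLpNorm (fun s => f (vert x s) - η s) 2 volume +
      eLpNorm (fun s => k (vert x s) - k (crit s)) 2 volume * eLpNorm η 2 volume)
      (𝓝[<] (1 / 2 : ℝ)) (𝓝 0) := by
    have h1 := ENNReal.Tendsto.const_mul (a := B) hf.boundary (Or.inr hBfin.ne)
    have h2 := ENNReal.Tendsto.mul_const (b := eLpNorm η 2 volume) hk.tendsto_sub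
      (Or.inr (Lp.memLp η).2.ne)
    rw [mul_zero] at h1
    rw [zero_mul] at h2
    simpa using h1.add h2
  have hle : ‖∫ s, k (crit s) * η s‖ₑ ≤ 0 := by
    refine ge_of_tendsto hlim ?_
    filter_upwards [self_mem_nhdsWithin] with x hx
    have hx : x < 1 / 2 := hx
    have hIx : Integrable fun s => k (vert x s) * f (vert x s) :=
      memLp_one_iff_integrable.1 ⟨(hk.aesm _).mul (hf.aesm hx), (hbd x hx).trans_lt
        (ENNReal.mul_lt_top ((hk.eLpNorm_vert_le hx.le).trans_lt hBfin) hC)⟩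
    have hsub : -∫ s, k (crit s) * η s =
        ∫ s, (k (vert x s) * f (vert x s) - k (crit s) * η s) := by
      rw [integral_sub hIx hIη, hzero x hx, zero_sub]
    rw [← enorm_neg, hsub]
    refine (enorm_integral_le_lintegral_enorm _).trans ?_
    rw [← eLpNorm_one_eq_lintegral_enorm]
    have hfη := (hf.aesm hx).sub hη2
    have hkk := (hk.aesm x).sub (hk.aesm (1 / 2))
    have hsplit : eLpNorm (fun s => k (vert x s) * f (vert x s) - k (crit s) * η s) 1 volume ≤
        eLpNorm (fun s => k (vert x s) * (f (vert x s) - η s)) 1 volume +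
        eLpNorm (fun s => (k (vert x s) - k (crit s)) * η s) 1 volume := by
      refine le_trans (le_of_eq ?_) (eLpNorm_add_le ((hk.aesm x).mul hfη) (hkk.mul hη2) le_rfl)
      congr 1
      funext s
      simp only [Pi.add_apply, crit]
      ring
    refine hsplit.trans (add_le_add ?_ (eLpNorm_one_mul_le hkk hη2))
    refine (eLpNorm_one_mul_le (hk.aesm x) hfη).trans ?_
    exact mul_le_mul_left (hk.eLpNorm_vert_le hx.le) _
  simpa using hle

end IsDecaying

/-- A function whose conjugate is the restriction of a decaying function to the critical line is
orthogonal to the Hardy space. -/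
theorem mem_hardy_orthogonal {k : ℂ → ℂ} {K : ℝ} (hk : IsDecaying k K) {ξ : L2}
    (hξ : ξ =ᵐ[volume] fun s => (starRingEnd ℂ) (k (crit s))) : ξ ∈ hardyᗮ := by
  rw [Submodule.mem_orthogonal']
  intro η hη
  rw [L2.inner_def, ← hk.integral_mul_eq_zero hη]
  refine integral_congr_ae ?_
  filter_upwards [hξ] with s hs
  rw [hs, RCLike.inner_apply, Complex.conj_conj, mul_comm]

/-! ### Linear growth of series of differences of powers. -/

/-- Bound for a difference of complex powers by the mean value inequality. -/
theorem norm_cpow_neg_sub_le {b l m : ℝ} (hb : 0 < b) (hl : b ≤ l) (hm : b ≤ m) {z : ℂ}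
    (hz : 0 ≤ z.re) :
    ‖(l : ℂ) ^ (-z) - (m : ℂ) ^ (-z)‖ ≤ ‖z‖ * b ^ (-z.re - 1) * |m - l| := by
  rcases eq_or_ne z 0 with rfl | hz0
  · simp
  have hd : ∀ t ∈ Set.Ici b, HasDerivWithinAt (fun t : ℝ => (t : ℂ) ^ (-z))
      (-z * (t : ℂ) ^ (-z - 1)) (Set.Ici b) t := by
    intro t ht
    have ht0 : t ≠ 0 := (hb.trans_le ht).ne'
    -- `hasDerivAt_ofReal_cpow_const'` differentiates `x ^ (r + 1) / (r + 1)`; with `r = -z - 1` a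
    -- factor `-z` recovers `x ^ (-z)`, whence the separate case `z = 0`.
    have hcancel : ∀ x : ℝ, (x : ℂ) ^ (-z) = -z * ((x : ℂ) ^ (-z - 1 + 1) / (-z - 1 + 1)) := by
      intro x
      rw [sub_add_cancel, ← mul_div_assoc, mul_div_cancel_left₀ _ (neg_ne_zero.2 hz0)]
    exact (hasDerivAt_ofReal_cpow_const' (r := -z - 1) ht0 (by simpa using hz0)).hasDerivWithinAt
      |>.const_mul (-z) |>.congr_deriv rfl |>.congr
      (fun x _ => hcancel x) (hcancel t)
  have hle : ∀ t ∈ Set.Ici b, ‖-z * (t : ℂ) ^ (-z - 1)‖ ≤ ‖z‖ * b ^ (-z.re - 1) := by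
    intro t ht
    have ht0 : 0 < t := hb.trans_le ht
    rw [norm_mul, norm_neg, Complex.norm_cpow_eq_rpow_re_of_pos ht0]
    gcongr
    simp only [Complex.sub_re, Complex.neg_re, Complex.one_re]
    exact Real.rpow_le_rpow_of_nonpos hb ht (by linarith)
  have := (convex_Ici b).norm_image_sub_le_of_norm_hasDerivWithin_le hd hle hm hl
  rwa [Real.norm_eq_abs, abs_sub_comm] at this

/-- An entire function given on `Re z > 1` by a series of differences `l⁻ᶻ - m⁻ᶻ` with
`l, m ≥ b ≥ A` has linear growth times `A⁻ᶻ` on `Re z ≥ 1/2`, provided the series is absolutely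
convergent to the left of that half plane. -/
theorem exists_norm_le_of_hasSum_cpow_sub {ι : Type*} {c : ι → ℂ} {l m b : ι → ℝ} {A : ℝ}
    (hA : 0 < A) (hb : ∀ i, A ≤ b i) (hl : ∀ i, b i ≤ l i) (hm : ∀ i, b i ≤ m i)
    (hs : Summable fun i => ‖c i‖ * (b i ^ (-(5 / 4) : ℝ) * |m i - l i|))
    {F : ℂ → ℂ} (hF : Differentiable ℂ F)
    (hsum : ∀ z : ℂ, 1 < z.re →
      HasSum (fun i => c i * ((l i : ℂ) ^ (-z) - (m i : ℂ) ^ (-z))) (F z)) :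
    ∃ K : ℝ, 0 ≤ K ∧ ∀ z : ℂ, 1 / 2 ≤ z.re → ‖F z‖ ≤ K * ‖z‖ * A ^ (-z.re) := by
  set t : ι → ℂ → ℂ := fun i z => c i * ((l i : ℂ) ^ (-z) - (m i : ℂ) ^ (-z)) with ht
  set u : ι → ℝ := fun i => ‖c i‖ * (b i ^ (-(5 / 4) : ℝ) * |m i - l i|) with hu
  have hu0 : ∀ i, 0 ≤ u i := fun i => by
    have := hA.trans_le (hb i)
    positivity
  -- The exponent `-5/4` is `-Re z - 1` at `Re z = 1/4`; what remains of the power of `b i ≥ A` is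
  -- at most `A ^ (1/4 - Re z)`.
  have hterm : ∀ i (z : ℂ), 1 / 4 ≤ z.re → ‖t i z‖ ≤ ‖z‖ * A ^ (1 / 4 - z.re) * u i := by
    intro i z hz
    have hb0 := hA.trans_le (hb i)
    have h1 := norm_cpow_neg_sub_le hb0 (hl i) (hm i) (z := z) (by linarith)
    have h2 : b i ^ (-z.re - 1) ≤ b i ^ (-(5 / 4) : ℝ) * A ^ (1 / 4 - z.re) := by
      rw [show -z.re - 1 = -(5 / 4) + (1 / 4 - z.re) by ring, Real.rpow_add hb0]
      gcongr ?_ * ?_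
      exact Real.rpow_le_rpow_of_nonpos hA (hb i) (by linarith)
    calc ‖t i z‖ ≤ ‖c i‖ * (‖z‖ * b i ^ (-z.re - 1) * |m i - l i|) := by
          rw [ht, norm_mul]
          gcongr
      _ ≤ ‖c i‖ * (‖z‖ * (b i ^ (-(5 / 4) : ℝ) * A ^ (1 / 4 - z.re)) * |m i - l i|) := by gcongr
      _ = ‖z‖ * A ^ (1 / 4 - z.re) * u i := by rw [hu]; ring
  have heq : ∀ z : ℂ, 1 / 2 ≤ z.re → F z = ∑' i, t i z := by
    intro z hz
    -- The region is convex, contains `z` and `2`, and is bounded so that the majorant is uniform;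
    -- the identity theorem from `2` then reaches `z`.
    set R : ℝ := ‖z‖ + 3 with hR
    set U : Set ℂ := {w : ℂ | 1 / 4 < w.re} ∩ Metric.ball 0 R with hU
    have hUo : IsOpen U := (isOpen_lt continuous_const Complex.continuous_re).inter Metric.isOpen_ball
    have hUc : Convex ℝ U := (convex_halfSpace_re_gt _).inter (convex_ball _ _)
    have hdiff : DifferentiableOn ℂ (fun w => ∑' i, t i w) U := by
      refine Complex.differentiableOn_tsum_of_summable_norm
        (u := fun i => R * Real.exp (|Real.log A| * R) * u i) (hs.mul_left _) (fun i => ?_) hUo ?_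
      · have hb0 := hA.trans_le (hb i)
        have hl0 : (l i : ℂ) ≠ 0 := by exact_mod_cast (hb0.trans_le (hl i)).ne'
        have hm0 : (m i : ℂ) ≠ 0 := by exact_mod_cast (hb0.trans_le (hm i)).ne'
        exact (((Differentiable.const_cpow differentiable_neg (Or.inl hl0)).sub
          (Differentiable.const_cpow differentiable_neg (Or.inl hm0))).const_mul _).differentiableOn
      · intro i w hw
        have hw1 : 1 / 4 < w.re := hw.1
        have hw2 : ‖w‖ < R := by simpa using hw.2
        refine (hterm i w hw1.le).trans ?_
        have hre : |1 / 4 - w.re| ≤ R := by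
          rw [abs_le]
          have := (abs_le.1 (Complex.abs_re_le_norm w))
          constructor <;> linarith [norm_nonneg z]
        have hexp : A ^ (1 / 4 - w.re) ≤ Real.exp (|Real.log A| * R) := by
          rw [Real.rpow_def_of_pos hA]
          refine Real.exp_le_exp.2 ((le_abs_self _).trans ?_)
          rw [abs_mul]
          gcongr
        have := hu0 i
        gcongr
    have hz2 : (2 : ℂ) ∈ U := by
      refine ⟨by change (1 / 4 : ℝ) < (2 : ℂ).re; norm_num, ?_⟩
      simp only [Metric.mem_ball, dist_zero_right, Complex.norm_ofNat, hR]
      linarith [norm_nonneg z]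
    refine (hF.differentiableOn.analyticOnNhd hUo).eqOn_of_preconnected_of_eventuallyEq
      (hdiff.analyticOnNhd hUo) hUc.isPreconnected hz2 ?_ ⟨?_, ?_⟩
    · have : {w : ℂ | 1 < w.re} ∈ 𝓝 (2 : ℂ) :=
        (isOpen_lt continuous_const Complex.continuous_re).mem_nhds
          (by change (1 : ℝ) < (2 : ℂ).re; norm_num)
      filter_upwards [this] with w hw
      exact (hsum w hw).tsum_eq.symm
    · change 1 / 4 < z.re
      linarith
    · simp only [Metric.mem_ball, dist_zero_right, hR]
      linarith
  have hK : 0 ≤ A ^ (1 / 4 : ℝ) * ∑' i, u i :=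
    mul_nonneg (by positivity) (tsum_nonneg hu0)
  refine ⟨_, hK, fun z hz => ?_⟩
  rw [heq z hz]
  refine (tsum_of_norm_bounded (hs.mul_left _).hasSum fun i => hterm i z (by linarith)).trans ?_
  rw [tsum_mul_left, sub_eq_add_neg, Real.rpow_add hA]
  exact le_of_eq (by ring)

/-! ### Growth of the Hurwitz and cosine zeta functions. -/

open HurwitzZeta

/-- The difference cancels the pole at `1`. All `|n + a|` are at least `2/5`, which gives the base,
and at least `|n| / 2`, which gives convergence. -/
theorem exists_norm_hurwitzZetaEven_sub_le {a a' : ℝ} (ha : a ∈ Set.Icc (2 / 5 : ℝ) (1 / 2))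
    (ha' : a' ∈ Set.Icc (2 / 5 : ℝ) (1 / 2)) :
    ∃ K : ℝ, 0 ≤ K ∧ ∀ z : ℂ, 1 / 2 ≤ z.re →
      ‖hurwitzZetaEven a z - hurwitzZetaEven a' z‖ ≤ K * ‖z‖ * (2 / 5 : ℝ) ^ (-z.re) := by
  have hlow : ∀ (n : ℤ) {x : ℝ}, x ∈ Set.Icc (2 / 5 : ℝ) (1 / 2) →
      max (2 / 5) (|(n : ℝ)| / 2) ≤ |n + x| := by
    intro n x hx
    obtain ⟨h1, h2⟩ := hx
    rcases lt_trichotomy n 0 with hn | rfl | hn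
    · have hn' : (n : ℝ) ≤ -1 := by exact_mod_cast Int.le_sub_one_of_lt hn
      rw [abs_of_neg (by linarith : (n : ℝ) < 0), abs_of_neg (by linarith : n + x < 0)]
      exact max_le (by linarith) (by linarith)
    · simp only [Int.cast_zero, abs_zero, zero_div, zero_add]
      rw [abs_of_nonneg (by linarith)]
      exact max_le h1 (by linarith)
    · have hn' : (1 : ℝ) ≤ n := by exact_mod_cast hn
      rw [abs_of_pos (by linarith : (0 : ℝ) < n), abs_of_pos (by linarith : 0 < n + x)]
      exact max_le (by linarith) (by linarith)
  refine exists_norm_le_of_hasSum_cpow_sub (c := fun _ : ℤ => 1 / 2)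
    (l := fun n : ℤ => |n + a|) (m := fun n : ℤ => |n + a'|)
    (b := fun n : ℤ => max (2 / 5) (|(n : ℝ)| / 2)) (by norm_num) (fun n => le_max_left _ _)
    (fun n => hlow n ha) (fun n => hlow n ha') ?_
    (differentiable_hurwitzZetaEven_sub_hurwitzZetaEven _ _) fun z hz => ?_
  · have hsum : Summable fun n : ℤ => (2 : ℝ) ^ (5 / 4 : ℝ) * |(n : ℝ)| ^ (-(5 / 4) : ℝ) :=
      (Real.summable_abs_int_rpow (by norm_num)).mul_left _
    refine Summable.of_norm_bounded_eventually hsum ?_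
    filter_upwards [(Set.finite_singleton (0 : ℤ)).compl_mem_cofinite] with n hn
    have hn0 : 0 < |(n : ℝ)| := by
      have : n ≠ 0 := hn
      positivity
    have h1 : (max (2 / 5) (|(n : ℝ)| / 2)) ^ (-(5 / 4) : ℝ) ≤
        (2 : ℝ) ^ (5 / 4 : ℝ) * |(n : ℝ)| ^ (-(5 / 4) : ℝ) := by
      refine (Real.rpow_le_rpow_of_nonpos (by positivity) (le_max_right _ _) (by norm_num)).trans ?_
      rw [Real.div_rpow hn0.le (by norm_num), Real.rpow_neg (by norm_num : (0 : ℝ) ≤ 2), div_inv_eq_mul,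
        mul_comm]
    have h2 : |(|(n : ℝ) + a'| - |n + a|)| ≤ 1 := by
      refine (abs_abs_sub_abs_le_abs_sub _ _).trans ?_
      rw [abs_le]
      obtain ⟨h1, h2⟩ := ha
      obtain ⟨h3, h4⟩ := ha'
      constructor <;> linarith
    rw [norm_mul, norm_norm, Real.norm_of_nonneg (by positivity)]
    have h3 : ‖(1 / 2 : ℂ)‖ ≤ 1 := by norm_num
    calc ‖(1 / 2 : ℂ)‖ * ((max (2 / 5) (|(n : ℝ)| / 2)) ^ (-(5 / 4) : ℝ) *
          |(|(n : ℝ) + a'| - |n + a|)|)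
        ≤ 1 * ((2 : ℝ) ^ (5 / 4 : ℝ) * |(n : ℝ)| ^ (-(5 / 4) : ℝ) * 1) := by gcongr
      _ = _ := by ring
  · refine ((hasSum_int_hurwitzZetaEven a hz).sub (hasSum_int_hurwitzZetaEven a' hz)).congr_fun
      fun n => ?_
    rw [Complex.cpow_neg, Complex.cpow_neg]
    ring

/-- Abel summation for a Dirichlet series with bounded partial sums of coefficients. -/
theorem exists_norm_le_of_bounded_sum {β : ℕ → ℂ} {B : ℝ}
    (hB : ∀ n, ‖∑ k ∈ Finset.range n, β k‖ ≤ B) {N : ℕ} (hN : 0 < N) (hβ : ∀ n < N, β n = 0)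
    {F : ℂ → ℂ} (hF : Differentiable ℂ F)
    (hsum : ∀ z : ℂ, 1 < z.re → HasSum (fun n : ℕ => β n / (n : ℂ) ^ z) (F z)) :
    ∃ K : ℝ, 0 ≤ K ∧ ∀ z : ℂ, 1 / 2 ≤ z.re → ‖F z‖ ≤ K * ‖z‖ * (N : ℝ) ^ (-z.re) := by
  set S : ℕ → ℂ := fun n => ∑ k ∈ Finset.range n, β k with hS
  have hS0 : ∀ n ≤ N, S n = 0 := fun n hn =>
    Finset.sum_eq_zero fun k hk => hβ k ((Finset.mem_range.1 hk).trans_le hn)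
  -- The Abel-summed series is `∑ S (k + 1) (k⁻ᶻ - (k + 1)⁻ᶻ)`; its terms with `k < N` vanish, and
  -- `k = n + N`.
  refine exists_norm_le_of_hasSum_cpow_sub (c := fun n => S (n + N + 1))
    (l := fun n : ℕ => (n : ℝ) + N) (m := fun n : ℕ => (n : ℝ) + N + 1)
    (b := fun n : ℕ => (n : ℝ) + N) (by exact_mod_cast hN) (fun n => by simp) (fun n => le_rfl)
    (fun n => by linarith) ?_ hF fun z hz => ?_
  · have h1 : Summable fun n : ℕ => B * (((n + N : ℕ) : ℝ) ^ (-(5 / 4) : ℝ)) :=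
      ((summable_nat_add_iff N).2 (Real.summable_nat_rpow.2 (by norm_num))).mul_left B
    refine h1.of_nonneg_of_le (fun n => by positivity) fun n => ?_
    simp only [add_sub_cancel_left, abs_one, mul_one, Nat.cast_add]
    gcongr
    exact hB _
  · have hz0 : z ≠ 0 := by
      rintro rfl
      norm_num at hz
    have hpow : Summable fun n : ℕ => ‖(n : ℂ) ^ (-z)‖ := by
      have := (Complex.summable_one_div_nat_cpow (p := z)).2 hz
      simpa [Complex.cpow_neg] using this.norm
    have hbdd : ∀ j, Summable fun n : ℕ => S (n + j) * (n : ℂ) ^ (-z) := fun j =>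
      Summable.of_norm_bounded (hpow.mul_left B) fun n => by
        rw [norm_mul]
        gcongr
        exact hB _
    have hq : HasSum (fun n : ℕ => S (n + 1) * ((n + 1 : ℕ) : ℂ) ^ (-z))
        (∑' n, S (n + 0) * (n : ℂ) ^ (-z)) := by
      have := (hasSum_nat_add_iff' 1).2 (hbdd 0).hasSum
      simpa [hS] using this
    have hF' : F z = ∑' n, S (n + 1) * (n : ℂ) ^ (-z) - ∑' n, S (n + 0) * (n : ℂ) ^ (-z) := by
      rw [← (hbdd 1).tsum_sub (hbdd 0), ← (hsum z hz).tsum_eq]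
      refine tsum_congr fun n => ?_
      simp only [hS, Finset.sum_range_succ, add_zero, Complex.cpow_neg]
      ring
    have h := (hbdd 1).hasSum.sub hq
    rw [← hF'] at h
    have h' := (hasSum_nat_add_iff' N).2 h
    rw [Finset.sum_eq_zero, sub_zero] at h'
    · refine h'.congr_fun fun n => ?_
      push_cast
      ring
    · intro n hn
      rw [hS0 _ (Finset.mem_range.1 hn)]
      ring

/-- Real part of a geometric sum whose ratio `w` differs from `1`, as `cos (2πa) ≤ 0` on this
interval. -/
theorem exists_norm_sum_cos_le {a : ℝ} (ha : a ∈ Set.Icc (2 / 5 : ℝ) (1 / 2)) :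
    ∃ B : ℝ, ∀ n : ℕ, |∑ k ∈ Finset.range n, Real.cos (2 * Real.pi * a * k)| ≤ B := by
  set w : ℂ := Complex.exp ((2 * Real.pi * a : ℝ) * Complex.I) with hw
  have hw1 : w ≠ 1 := by
    intro h
    have hre : Real.cos (2 * Real.pi * a) = 1 := by
      rw [← Complex.exp_ofReal_mul_I_re, ← hw, h, Complex.one_re]
    have hneg : Real.cos (2 * Real.pi * a) ≤ 0 := by
      apply Real.cos_nonpos_of_pi_div_two_le_of_le <;> nlinarith [Real.pi_pos, ha.1, ha.2]
    linarith
  refine ⟨2 / ‖w - 1‖, fun n => ?_⟩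
  have hsum : ∑ k ∈ Finset.range n, Real.cos (2 * Real.pi * a * k) =
      (∑ k ∈ Finset.range n, w ^ k).re := by
    rw [Complex.re_sum]
    refine Finset.sum_congr rfl fun k _ => ?_
    rw [hw, ← Complex.exp_nat_mul, ← Complex.exp_ofReal_mul_I_re]
    congr 2
    push_cast
    ring
  rw [hsum]
  refine (Complex.abs_re_le_norm _).trans ?_
  rw [geom_sum_eq hw1, norm_div]
  gcongr
  refine (norm_sub_le _ _).trans ?_
  rw [norm_pow, hw, Complex.norm_exp_ofReal_mul_I]
  norm_num

/-! ### Third differences of zeta functions and the functional equation. -/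

/-- Points of `[2/5, 1/2]` at which `cos (2πa)` takes equally spaced values. -/
def node (j : ℕ) : ℝ := Real.arccos (-1 + j / 20) / (2 * Real.pi)

theorem cos_node {j : ℕ} (hj : j ≤ 3) : Real.cos (2 * Real.pi * node j) = -1 + j / 20 := by
  have hj' : (j : ℝ) ≤ 3 := by exact_mod_cast hj
  have hj0 : (0 : ℝ) ≤ j := j.cast_nonneg
  rw [node, mul_div_cancel₀ _ (by positivity), Real.cos_arccos (by linarith) (by linarith)]

theorem node_mem {j : ℕ} (hj : j ≤ 3) : node j ∈ Set.Icc (2 / 5 : ℝ) (1 / 2) := by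
  have hj' : (j : ℝ) ≤ 3 := by exact_mod_cast hj
  have hpi := Real.pi_pos
  have h1 : Real.pi - Real.pi / 5 ≤ Real.arccos (-1 + j / 20) := by
    rw [← Real.arccos_cos (x := Real.pi - Real.pi / 5) (by linarith) (by linarith)]
    refine Real.arccos_le_arccos ?_
    -- The bound `√5 ≤ 12/5` gives `cos (4π/5) = -(1 + √5)/4 ≥ -17/20`, exactly the value at `j =
    -- 3`.
    rw [Real.cos_pi_sub, Real.cos_pi_div_five]
    have : Real.sqrt 5 ≤ 12 / 5 := by
      rw [Real.sqrt_le_left (by norm_num)]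
      norm_num
    linarith
  have h2 := Real.arccos_le_pi (-1 + (j : ℝ) / 20)
  rw [node, Set.mem_Icc, le_div_iff₀ (by positivity), div_le_iff₀ (by positivity)]
  constructor <;> linarith

theorem node_ne_zero {j : ℕ} (hj : j ≤ 3) : (node j : UnitAddCircle) ≠ 0 := by
  intro h
  obtain ⟨n, hn⟩ := (AddCircle.coe_eq_zero_iff _).1 h
  obtain ⟨h1, h2⟩ := node_mem hj
  simp only [zsmul_eq_mul, mul_one] at hn
  rw [← hn] at h1 h2
  have h3 : (0 : ℤ) < n := by
    have : (0 : ℝ) < n := by linarith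
    exact_mod_cast this
  have h4 : (1 : ℝ) ≤ n := by exact_mod_cast h3
  linarith

/-- The third difference of a function of `node`. -/
def thirdDiff {V : Type*} [AddCommGroup V] [Module ℂ V] (φ : ℝ → V) : V :=
  φ (node 0) - (3 : ℂ) • φ (node 1) + (3 : ℂ) • φ (node 2) - φ (node 3)

/-- The coefficients of the Dirichlet series `cosDiff`. -/
def coeffDiff (n : ℕ) : ℂ := thirdDiff fun a => (Real.cos (2 * Real.pi * a * n) : ℂ)

/-- A combination of cosine zeta functions whose Dirichlet series starts at `n = 3`. -/
def cosDiff (z : ℂ) : ℂ := thirdDiff fun a => cosZeta a z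

/-- The combination of Hurwitz zeta functions dual to `cosDiff`. -/
def hurwitzDiff (z : ℂ) : ℂ := thirdDiff fun a => hurwitzZetaEven a z

/-- `cos (2πna)` is a polynomial of degree `n` in `cos (2πa)`, and a third difference at equally
spaced values kills degree at most `2`. -/
theorem coeffDiff_eq_zero {n : ℕ} (hn : n < 3) : coeffDiff n = 0 := by
  have h0 := cos_node (j := 0) (by norm_num)
  have h1 := cos_node (j := 1) (by norm_num)
  have h2 := cos_node (j := 2) (by norm_num)
  have h3 := cos_node (j := 3) (by norm_num)
  simp only [coeffDiff, thirdDiff, smul_eq_mul]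
  interval_cases n
  · simp
  · simp only [Nat.cast_one, mul_one, h0, h1, h2, h3]
    push_cast
    ring
  · have h : ∀ a : ℝ, Real.cos (2 * Real.pi * a * (2 : ℕ)) = 2 * Real.cos (2 * Real.pi * a) ^ 2 - 1 :=
      fun a => by rw [← Real.cos_two_mul]; congr 1; push_cast; ring
    simp only [h, h0, h1, h2, h3]
    push_cast
    ring

/-- The cubic term of `cos (3θ)` survives the third difference; hence `cosDiff` is not identically
zero. -/
theorem coeffDiff_three_ne_zero : coeffDiff 3 ≠ 0 := by
  have h0 := cos_node (j := 0) (by norm_num)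
  have h1 := cos_node (j := 1) (by norm_num)
  have h2 := cos_node (j := 2) (by norm_num)
  have h3 := cos_node (j := 3) (by norm_num)
  have h : ∀ a : ℝ, Real.cos (2 * Real.pi * a * (3 : ℕ)) =
      4 * Real.cos (2 * Real.pi * a) ^ 3 - 3 * Real.cos (2 * Real.pi * a) :=
    fun a => by rw [← Real.cos_three_mul]; congr 1; push_cast; ring
  simp only [coeffDiff, thirdDiff, smul_eq_mul, h, h0, h1, h2, h3]
  push_cast
  norm_num

theorem hasSum_cosDiff {z : ℂ} (hz : 1 < z.re) :
    HasSum (fun n : ℕ => coeffDiff n / (n : ℂ) ^ z) (cosDiff z) := by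
  have h := fun j => hasSum_nat_cosZeta (node j) hz
  refine ((((h 0).sub ((h 1).const_smul (3 : ℂ))).add ((h 2).const_smul (3 : ℂ))).sub
    (h 3)).congr_fun fun n => ?_
  simp only [coeffDiff, thirdDiff, smul_eq_mul]
  ring

theorem differentiable_cosDiff : Differentiable ℂ cosDiff := by
  have h := fun (j : ℕ) (hj : j ≤ 3) => differentiable_cosZeta_of_ne_zero (node_ne_zero hj)
  exact (((h 0 (by norm_num)).sub ((h 1 (by norm_num)).const_smul (3 : ℂ))).add
    ((h 2 (by norm_num)).const_smul (3 : ℂ))).sub (h 3 (by norm_num))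

theorem exists_norm_cosDiff_le : ∃ K : ℝ, 0 ≤ K ∧ ∀ z : ℂ, 1 / 2 ≤ z.re →
    ‖cosDiff z‖ ≤ K * ‖z‖ * (3 : ℕ) ^ (-z.re) := by
  obtain ⟨B₀, h0⟩ := exists_norm_sum_cos_le (node_mem (j := 0) (by norm_num))
  obtain ⟨B₁, h1⟩ := exists_norm_sum_cos_le (node_mem (j := 1) (by norm_num))
  obtain ⟨B₂, h2⟩ := exists_norm_sum_cos_le (node_mem (j := 2) (by norm_num))
  obtain ⟨B₃, h3⟩ := exists_norm_sum_cos_le (node_mem (j := 3) (by norm_num))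
  refine exists_norm_le_of_bounded_sum (β := coeffDiff) (B := B₀ + 3 * B₁ + 3 * B₂ + B₃)
    (fun n => ?_) (by norm_num) (fun n hn => coeffDiff_eq_zero hn) differentiable_cosDiff
    fun z hz => hasSum_cosDiff hz
  have hsum : ∑ k ∈ Finset.range n, coeffDiff k =
      thirdDiff fun a => ((∑ k ∈ Finset.range n, Real.cos (2 * Real.pi * a * k) : ℝ) : ℂ) := by
    simp only [coeffDiff, thirdDiff, Finset.sum_sub_distrib, Finset.sum_add_distrib,
      ← Finset.smul_sum, Complex.ofReal_sum]
  have h0 := h0 n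
  have h1 := h1 n
  have h2 := h2 n
  have h3 := h3 n
  rw [← Real.norm_eq_abs, ← Complex.norm_real] at h0 h1 h2 h3
  rw [hsum, thirdDiff]
  refine (norm_sub_le _ _).trans (add_le_add ((norm_add_le _ _).trans (add_le_add
    ((norm_sub_le _ _).trans (add_le_add h0 ?_)) ?_)) h3) <;>
  · rw [norm_smul, Complex.norm_ofNat]
    gcongr

/-- The coefficients `1, -3, 3, -1` sum to zero, so only first differences occur and the poles at
`1` cancel. -/
theorem hurwitzDiff_eq (z : ℂ) : hurwitzDiff z =
    (hurwitzZetaEven (node 0) z - hurwitzZetaEven (node 1) z) -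
      2 * (hurwitzZetaEven (node 1) z - hurwitzZetaEven (node 2) z) +
      (hurwitzZetaEven (node 2) z - hurwitzZetaEven (node 3) z) := by
  simp only [hurwitzDiff, thirdDiff, smul_eq_mul]
  ring

theorem differentiable_hurwitzDiff : Differentiable ℂ hurwitzDiff := by
  rw [funext hurwitzDiff_eq]
  have h := fun i j => differentiable_hurwitzZetaEven_sub_hurwitzZetaEven (node i) (node j)
  exact ((h 0 1).sub ((h 1 2).const_mul 2)).add (h 2 3)

theorem exists_norm_hurwitzDiff_le : ∃ K : ℝ, 0 ≤ K ∧ ∀ z : ℂ, 1 / 2 ≤ z.re →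
    ‖hurwitzDiff z‖ ≤ K * ‖z‖ * (2 / 5 : ℝ) ^ (-z.re) := by
  have h := fun (i j : ℕ) (hi : i ≤ 3) (hj : j ≤ 3) =>
    exists_norm_hurwitzZetaEven_sub_le (node_mem hi) (node_mem hj)
  obtain ⟨K₀, hK₀, h0⟩ := h 0 1 (by norm_num) (by norm_num)
  obtain ⟨K₁, hK₁, h1⟩ := h 1 2 (by norm_num) (by norm_num)
  obtain ⟨K₂, hK₂, h2⟩ := h 2 3 (by norm_num) (by norm_num)
  refine ⟨K₀ + 2 * K₁ + K₂, by positivity, fun z hz => ?_⟩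
  rw [hurwitzDiff_eq]
  refine (norm_add_le _ _).trans ((add_le_add_left (norm_sub_le _ _) _).trans ?_)
  rw [norm_mul, Complex.norm_ofNat]
  have h0 := h0 z hz
  have h1 := h1 z hz
  have h2 := h2 z hz
  nlinarith

theorem rho_none_mul_cosDiff (s : ℝ) :
    rho none (crit s) * cosDiff (crit s) = hurwitzDiff (1 - crit s) := by
  set z := crit s with hz
  have hre : z.re = 1 / 2 := crit_re s
  have hz0 : z ≠ 0 := by
    intro h
    rw [h] at hre
    norm_num at hre
  have hz1 : 1 - z ≠ 0 := by
    intro h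
    have := congrArg Complex.re h
    rw [Complex.sub_re, hre] at this
    norm_num at this
  have hG : Complex.Gammaℝ z ≠ 0 := Complex.Gammaℝ_ne_zero_of_re_pos (by rw [hre]; norm_num)
  have hG1 : Complex.Gammaℝ (1 - z) ≠ 0 :=
    Complex.Gammaℝ_ne_zero_of_re_pos (by rw [Complex.sub_re, hre]; norm_num)
  have hrho : rho none z = Complex.Gammaℝ z / Complex.Gammaℝ (1 - z) := rfl
  have h : ∀ a : UnitAddCircle, rho none z * cosZeta a z = hurwitzZetaEven a (1 - z) := by
    intro a
    rw [hurwitzZetaEven_def_of_ne_or_ne (Or.inr hz1), completedHurwitzZetaEven_one_sub, cosZeta,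
      Function.update_of_ne hz0, hrho]
    field_simp
  simp only [cosDiff, hurwitzDiff, thirdDiff, smul_eq_mul, ← h]
  ring

/-- Otherwise uniqueness of Dirichlet coefficients would contradict `coeffDiff 3 ≠ 0`; summability
at `2` excludes the case of a series that converges nowhere. -/
theorem exists_cosDiff_ne_zero : ∃ x : ℝ, 1 < x ∧ cosDiff x ≠ 0 := by
  by_contra! hcon
  have hL : ∀ x : ℝ, 1 < x → LSeriesHasSum coeffDiff x (cosDiff x) := fun x hx =>
    (hasSum_cosDiff (z := x) (by simpa using hx)).congr_fun
      (LSeries.term_of_ne_zero' (by exact_mod_cast (by linarith : x ≠ 0)) _)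
  have hev : (fun x : ℝ => LSeries coeffDiff x) =ᶠ[atTop] 0 := by
    filter_upwards [eventually_gt_atTop 1] with x hx
    rw [(hL x hx).LSeries_eq, hcon x hx, Pi.zero_apply]
  rcases LSeries_eventually_eq_zero_iff'.1 hev with h | h
  · exact coeffDiff_three_ne_zero (h 3 (by norm_num))
  · have := (hL 2 (by norm_num)).LSeriesSummable.abscissaOfAbsConv_le
    rw [h] at this
    exact absurd this (by simp)

/-! ### The weight of small exponential type. -/

/-- The entire function `w ↦ sinh (ε w) / w`. -/
def sinhQuot (ε : ℝ) : ℂ → ℂ := dslope (fun w : ℂ => Complex.sinh (ε * w)) 0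

theorem sinhQuot_of_ne (ε : ℝ) {w : ℂ} (hw : w ≠ 0) :
    sinhQuot ε w = Complex.sinh (ε * w) / w := by
  rw [sinhQuot, dslope_of_ne _ hw, slope_def_field]
  simp

theorem differentiable_sinhQuot (ε : ℝ) : Differentiable ℂ (sinhQuot ε) := by
  rw [← differentiableOn_univ, sinhQuot, Complex.differentiableOn_dslope univ_mem]
  have : Differentiable ℂ fun w : ℂ => Complex.sinh (ε * w) := by fun_prop
  exact this.differentiableOn

theorem exists_norm_sinhQuot_le {ε : ℝ} (hε : 0 ≤ ε) : ∃ K : ℝ, 0 ≤ K ∧ ∀ w : ℂ,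
    ‖sinhQuot ε w‖ ≤ K * Real.exp (ε * |w.re|) / (1 + ‖w‖) := by
  obtain ⟨B, hB⟩ := (isCompact_closedBall (0 : ℂ) 1).exists_bound_of_continuousOn
    (differentiable_sinhQuot ε).continuous.continuousOn
  have hB0 : 0 ≤ B := (norm_nonneg _).trans (hB 0 (by simp))
  refine ⟨2 * B + 2, by positivity, fun w => ?_⟩
  have hexp : 1 ≤ Real.exp (ε * |w.re|) := Real.one_le_exp (by positivity)
  rw [le_div_iff₀ (by positivity)]
  rcases le_total ‖w‖ 1 with hw | hw
  · have h := hB w (by simpa using hw)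
    calc ‖sinhQuot ε w‖ * (1 + ‖w‖) ≤ B * (1 + 1) := by gcongr
      _ ≤ (2 * B + 2) * 1 := by linarith
      _ ≤ _ := by gcongr
  · have hw0 : w ≠ 0 := by
      rintro rfl
      simp at hw
      linarith
    have hs : ‖Complex.sinh (ε * w)‖ ≤ Real.exp (ε * |w.re|) := by
      rw [Complex.sinh, norm_div, Complex.norm_ofNat, div_le_iff₀ (by norm_num)]
      refine (norm_sub_le _ _).trans ?_
      rw [Complex.norm_exp, Complex.norm_exp]
      have h1 : ((ε : ℂ) * w).re ≤ ε * |w.re| := by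
        rw [Complex.re_ofReal_mul]
        gcongr
        exact le_abs_self _
      have h2 : (-((ε : ℂ) * w)).re ≤ ε * |w.re| := by
        rw [Complex.neg_re, Complex.re_ofReal_mul, ← mul_neg]
        gcongr
        exact neg_le_abs _
      have h3 := Real.exp_le_exp.2 h1
      have h4 := Real.exp_le_exp.2 h2
      linarith
    rw [sinhQuot_of_ne ε hw0, norm_div, div_mul_eq_mul_div, div_le_iff₀ (by linarith)]
    calc ‖Complex.sinh (ε * w)‖ * (1 + ‖w‖) ≤ Real.exp (ε * |w.re|) * (‖w‖ + ‖w‖) := by gcongr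
      _ ≤ (2 * B + 2) * Real.exp (ε * |w.re|) * ‖w‖ := by
        nlinarith [mul_nonneg hB0 (mul_nonneg (Real.exp_pos (ε * |w.re|)).le (norm_nonneg w))]

/-- An entire weight of small exponential type around `exp z`, decaying on vertical lines like
`‖z‖ ^ (-(n + 2))`. -/
def weight (n : ℕ) (z : ℂ) : ℂ :=
  Complex.exp z * sinhQuot (1 / (20 * (n + 2))) (z - 1 / 2) ^ (n + 2)

theorem differentiable_weight (n : ℕ) : Differentiable ℂ (weight n) := by
  refine Complex.differentiable_exp.mul (Differentiable.pow ?_ _)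
  exact (differentiable_sinhQuot _).comp (differentiable_id.sub (differentiable_const _))

/-- The `n + 2` factors of type `1 / (20 (n + 2))` have total type `1/20` for every `n`. Of their
decay, `n` powers absorb `z ^ i`; of the two left, one will pay for the linear growth of the zeta
side and one for square integrability. -/
theorem exists_norm_pow_mul_weight_le {i n : ℕ} (hi : i ≤ n) : ∃ K : ℝ, 0 ≤ K ∧ ∀ z : ℂ,
    ‖z ^ i * weight n z‖ ≤ K * Real.exp (z.re + |z.re - 1 / 2| / 20) / (1 + ‖z‖) ^ 2 := by
  obtain ⟨K, hK, h⟩ := exists_norm_sinhQuot_le (ε := 1 / (20 * (n + 2))) (by positivity)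
  refine ⟨(2 * K) ^ (n + 2), by positivity, fun z => ?_⟩
  have hre : (z - 1 / 2).re = z.re - 1 / 2 := by
    rw [Complex.sub_re]
    norm_num
  have hnorm : 1 + ‖z‖ ≤ 2 * (1 + ‖z - 1 / 2‖) := by
    have h1 : ‖z‖ ≤ ‖z - 1 / 2‖ + ‖(1 / 2 : ℂ)‖ := by
      simpa using norm_add_le (z - 1 / 2) (1 / 2)
    have h2 : ‖(1 / 2 : ℂ)‖ = 1 / 2 := by norm_num
    linarith [norm_nonneg (z - 1 / 2)]
  have hS : ‖sinhQuot (1 / (20 * (n + 2))) (z - 1 / 2)‖ ≤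
      2 * K * Real.exp (1 / (20 * (n + 2)) * |z.re - 1 / 2|) / (1 + ‖z‖) := by
    refine (h _).trans ?_
    rw [hre, div_le_div_iff₀ (by positivity) (by positivity)]
    calc _ ≤ K * Real.exp (1 / (20 * (n + 2)) * |z.re - 1 / 2|) * (2 * (1 + ‖z - 1 / 2‖)) := by
          gcongr
      _ = _ := by ring
  have hz : ‖z ^ i‖ ≤ (1 + ‖z‖) ^ n := by
    rw [norm_pow]
    calc ‖z‖ ^ i ≤ (1 + ‖z‖) ^ i := by gcongr; linarith
      _ ≤ (1 + ‖z‖) ^ n := by gcongr; linarith [norm_nonneg z]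
  rw [weight, norm_mul, norm_mul (Complex.exp z), norm_pow (sinhQuot _ _), Complex.norm_exp]
  calc ‖z ^ i‖ * (Real.exp z.re * ‖sinhQuot (1 / (20 * (n + 2))) (z - 1 / 2)‖ ^ (n + 2))
      ≤ (1 + ‖z‖) ^ n * (Real.exp z.re *
        (2 * K * Real.exp (1 / (20 * (n + 2)) * |z.re - 1 / 2|) / (1 + ‖z‖)) ^ (n + 2)) := by
        gcongr
    _ = (2 * K) ^ (n + 2) * (Real.exp z.re *
        Real.exp (1 / (20 * (n + 2)) * |z.re - 1 / 2|) ^ (n + 2)) / (1 + ‖z‖) ^ 2 := by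
        rw [div_pow, mul_pow, pow_add (1 + ‖z‖)]
        field_simp
    _ = _ := by
        rw [← Real.exp_nat_mul, ← Real.exp_add]
        congr 4
        push_cast
        field_simp

/-- The gap between `e` and `3` leaves room for the type `1/20` of `weight`;
`two_fifths_rpow_neg_le` is the counterpart for `5/2`. -/
theorem three_rpow_neg_le {x : ℝ} (hx : 0 ≤ x) :
    ((3 : ℕ) : ℝ) ^ (-x) ≤ Real.exp (-(21 / 20) * x) := by
  have h3 : Real.exp (21 / 20) ≤ 3 := by
    have h1 := Real.exp_one_lt_d9
    have h2 : (19 / 20 : ℝ) ≤ Real.exp (-(1 / 20)) := by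
      have := Real.add_one_le_exp (-(1 / 20 : ℝ))
      linarith
    have h4 : Real.exp (21 / 20) * Real.exp (-(1 / 20)) = Real.exp 1 := by
      rw [← Real.exp_add]
      norm_num
    nlinarith [Real.exp_pos (21 / 20)]
  have h4 : (Real.exp (21 / 20)) ^ x ≤ 3 ^ x := Real.rpow_le_rpow (Real.exp_pos _).le h3 hx
  rw [← Real.exp_mul] at h4
  rw [Nat.cast_ofNat, Real.rpow_neg (by norm_num), neg_mul, Real.exp_neg]
  exact inv_anti₀ (Real.exp_pos _) h4

theorem two_fifths_rpow_neg_le {x : ℝ} (hx : 0 ≤ x) :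
    (2 / 5 : ℝ) ^ (-x) ≤ Real.exp (19 / 20 * x) := by
  have h3 : 5 / 2 ≤ Real.exp (19 / 20) := by
    have h1 := Real.exp_one_gt_d9
    have h2 : (19 / 20 : ℝ) ≤ Real.exp (-(1 / 20)) := by
      have := Real.add_one_le_exp (-(1 / 20 : ℝ))
      linarith
    have h4 : Real.exp 1 * Real.exp (-(1 / 20)) = Real.exp (19 / 20) := by
      rw [← Real.exp_add]
      norm_num
    nlinarith
  rw [Real.rpow_neg (by norm_num), ← Real.inv_rpow (by norm_num), Real.exp_mul]
  exact Real.rpow_le_rpow (by norm_num) (by norm_num; linarith) hx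

/-! ### Vectors of the archimedean Sonin space. -/

/-- An entire function whose restriction to the critical line lies in the archimedean Sonin
space. -/
def soninFun (n i : ℕ) (z : ℂ) : ℂ := z ^ i * weight n z * cosDiff z

/-- The extension to `Re z < 1/2` of the product of `soninFun` by `ρ_∞`. -/
def soninDual (n i : ℕ) (z : ℂ) : ℂ := z ^ i * weight n z * hurwitzDiff (1 - z)

theorem differentiable_soninFun (n i : ℕ) : Differentiable ℂ (soninFun n i) :=
  ((differentiable_id.pow i).mul (differentiable_weight n)).mul differentiable_cosDiff

theorem exists_norm_soninFun_le {i n : ℕ} (hi : i ≤ n) : ∃ K : ℝ, 0 ≤ K ∧ ∀ z : ℂ,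
    1 / 2 ≤ z.re → ‖soninFun n i z‖ ≤ K / (1 + ‖z‖) := by
  obtain ⟨K, hK, h⟩ := exists_norm_pow_mul_weight_le hi
  obtain ⟨K', hK', h'⟩ := exists_norm_cosDiff_le
  refine ⟨K * K', by positivity, fun z hz => ?_⟩
  have h3 := three_rpow_neg_le (x := z.re) (by linarith)
  -- The terms in `z.re` cancel exactly and the exponent is `-1/40`.
  have hexp : Real.exp (z.re + |z.re - 1 / 2| / 20) * Real.exp (-(21 / 20) * z.re) ≤ 1 := by
    rw [← Real.exp_add, Real.exp_le_one_iff, abs_of_nonneg (by linarith)]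
    linarith
  rw [soninFun, norm_mul]
  calc ‖z ^ i * weight n z‖ * ‖cosDiff z‖
      ≤ (K * Real.exp (z.re + |z.re - 1 / 2| / 20) / (1 + ‖z‖) ^ 2) *
        (K' * (1 + ‖z‖) * Real.exp (-(21 / 20) * z.re)) := by
        refine mul_le_mul (h z) ((h' z hz).trans ?_) (norm_nonneg _) (by positivity)
        gcongr
        linarith
    _ = K * K' / (1 + ‖z‖) * (Real.exp (z.re + |z.re - 1 / 2| / 20) *
        Real.exp (-(21 / 20) * z.re)) := by field_simp
    _ ≤ K * K' / (1 + ‖z‖) := mul_le_of_le_one_right (by positivity) hexp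

theorem exists_isDecaying_soninDual {i n : ℕ} (hi : i ≤ n) :
    ∃ K : ℝ, IsDecaying (soninDual n i) K := by
  obtain ⟨K, hK, h⟩ := exists_norm_pow_mul_weight_le hi
  obtain ⟨K', hK', h'⟩ := exists_norm_hurwitzDiff_le
  refine ⟨K * K' * Real.exp 1, ((differentiable_id.pow i).mul (differentiable_weight n)).mul
    (differentiable_hurwitzDiff.comp ((differentiable_const _).sub differentiable_id)),
    fun z hz => ?_⟩
  have hre : (1 - z).re = 1 - z.re := by simp
  have h3 := two_fifths_rpow_neg_le (x := (1 - z).re) (by rw [hre]; linarith)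
  have hnorm : ‖1 - z‖ ≤ 1 + ‖z‖ := by simpa using norm_sub_le 1 z
  -- Here too `z.re` cancels; the exponent is `39/40`.
  have hexp : Real.exp (z.re + |z.re - 1 / 2| / 20) * Real.exp (19 / 20 * (1 - z).re) ≤
      Real.exp 1 := by
    rw [← Real.exp_add, Real.exp_le_exp, abs_of_nonpos (by linarith), hre]
    linarith
  rw [soninDual, norm_mul]
  calc ‖z ^ i * weight n z‖ * ‖hurwitzDiff (1 - z)‖
      ≤ (K * Real.exp (z.re + |z.re - 1 / 2| / 20) / (1 + ‖z‖) ^ 2) *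
        (K' * (1 + ‖z‖) * Real.exp (19 / 20 * (1 - z).re)) := by
        refine mul_le_mul (h z) ((h' _ (by rw [hre]; linarith)).trans ?_) (norm_nonneg _)
          (by positivity)
        gcongr
    _ = K * K' / (1 + ‖z‖) * (Real.exp (z.re + |z.re - 1 / 2| / 20) *
        Real.exp (19 / 20 * (1 - z).re)) := by field_simp
    _ ≤ K * K' / (1 + ‖z‖) * Real.exp 1 := by gcongr
    _ = _ := by ring

/-- The reflection of a function in the critical line. -/
def reflect (g : ℂ → ℂ) (z : ℂ) : ℂ := (starRingEnd ℂ) (g (1 - (starRingEnd ℂ) z))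

theorem reflect_crit (g : ℂ → ℂ) (s : ℝ) : reflect g (crit s) = (starRingEnd ℂ) (g (crit s)) := by
  rw [reflect, ← one_sub_crit, sub_sub_cancel]

/-- Reflection carries the bound on `Re z ≥ 1/2` to the left half plane and conjugates the values on
the line, as `mem_hardy_orthogonal` requires. -/
theorem exists_isDecaying_reflect_soninFun {i n : ℕ} (hi : i ≤ n) :
    ∃ K : ℝ, IsDecaying (reflect (soninFun n i)) K := by
  obtain ⟨K, hK, h⟩ := exists_norm_soninFun_le hi
  refine ⟨2 * K, fun z => ?_, fun z hz => ?_⟩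
  · have hd : Differentiable ℂ fun z => soninFun n i (1 - z) :=
      (differentiable_soninFun n i).comp ((differentiable_const _).sub differentiable_id)
    have h1 := (hd ((starRingEnd ℂ) z)).conj_conj
    rw [Complex.conj_conj] at h1
    exact h1
  · rw [reflect, RCLike.norm_conj]
    refine (h _ (by simp; linarith)).trans ?_
    rw [div_le_div_iff₀ (by positivity) (by positivity)]
    have hnorm : ‖z‖ ≤ 1 + ‖1 - (starRingEnd ℂ) z‖ := by
      have := norm_sub_le 1 (1 - (starRingEnd ℂ) z)
      rwa [sub_sub_cancel, RCLike.norm_conj, norm_one] at this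
    nlinarith [norm_nonneg (1 - (starRingEnd ℂ) z)]

theorem memLp_soninFun {i n : ℕ} (hi : i ≤ n) :
    MemLp (fun s => soninFun n i (crit s)) 2 volume := by
  obtain ⟨K, hK⟩ := exists_isDecaying_reflect_soninFun hi
  have := hK.memLp_crit.star
  refine this.congr_norm
    ((differentiable_soninFun n i).continuous.comp continuous_crit).aestronglyMeasurable
    (Eventually.of_forall fun s => ?_)
  simp [reflect_crit]

theorem toLp_soninFun_mem_sonin {i n : ℕ} (hi : i ≤ n) :
    (memLp_soninFun hi).toLp _ ∈ sonin (uF {none}) := by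
  have hae := (memLp_soninFun hi).coeFn_toLp
  rw [mem_sonin_iff]
  constructor
  · obtain ⟨K, hK⟩ := exists_isDecaying_reflect_soninFun hi
    refine mem_hardy_orthogonal hK ?_
    filter_upwards [hae] with s hs
    rw [hs, reflect_crit, Complex.conj_conj]
  · obtain ⟨K, hK⟩ := exists_isDecaying_soninDual hi
    refine hardy.le_topologicalClosure ?_
    convert! hK.toLp_mem_hardy using 1
    refine Lp.ext ?_
    filter_upwards [hae, uF_apply {none} ((memLp_soninFun hi).toLp _),
      hK.memLp_crit.coeFn_toLp] with s h1 h2 h3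
    rw [h2, h1, h3, uProd, Finset.prod_singleton, soninFun, soninDual, ← rho_none_mul_cosDiff]
    ring

/-! ### Linear independence and infinite dimension. -/

/-- An entire function that vanishes on the critical line is zero. -/
theorem eq_zero_of_crit {g : ℂ → ℂ} (hg : Differentiable ℂ g) (h : ∀ s, g (crit s) = 0) :
    g = 0 := by
  have han : AnalyticOnNhd ℂ g Set.univ := hg.differentiableOn.analyticOnNhd isOpen_univ
  have hinj : Function.Injective crit := fun s t hst => by
    have := congrArg Complex.im hst
    rwa [crit, crit, vert_im, vert_im] at this
  have hlim : Tendsto crit (𝓝[≠] 0) (𝓝[≠] (crit 0)) :=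
    continuous_crit.continuousAt.continuousWithinAt.tendsto_nhdsWithin
      fun s hs => fun h' => hs (hinj h')
  exact han.eq_of_frequently_eq analyticOnNhd_const
    (hlim.frequently (Eventually.of_forall (p := fun s => g (crit s) = 0) h).frequently)

theorem exists_weight_mul_cosDiff_ne_zero (n : ℕ) : ∃ z : ℂ, weight n z * cosDiff z ≠ 0 := by
  obtain ⟨x, hx, h⟩ := exists_cosDiff_ne_zero
  refine ⟨x, mul_ne_zero (mul_ne_zero (Complex.exp_ne_zero _) (pow_ne_zero _ ?_)) h⟩
  have hc : (x : ℂ) - 1 / 2 = ((x - 1 / 2 : ℝ) : ℂ) := by push_cast; ring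
  have hne : x - 1 / 2 ≠ 0 := by linarith
  rw [hc, sinhQuot_of_ne _ (by exact_mod_cast hne), ← Complex.ofReal_mul, ← Complex.ofReal_sinh,
    ← Complex.ofReal_div]
  have h2 : Real.sinh (1 / (20 * (n + 2)) * (x - 1 / 2)) ≠ 0 := by
    rw [Ne, Real.sinh_eq_zero]
    exact mul_ne_zero (by positivity) hne
  exact_mod_cast div_ne_zero h2 hne

/-- A relation says that a polynomial times `weight n * cosDiff` vanishes almost everywhere on the
line, hence everywhere by continuity and analyticity. The polynomial then vanishes on an open set
where the other factor has no zero. -/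
theorem linearIndependent_soninFun (n : ℕ) : LinearIndependent ℂ fun i : Fin (n + 1) =>
    (⟨_, toLp_soninFun_mem_sonin (Nat.lt_succ_iff.1 i.2)⟩ : sonin (uF {none})) := by
  rw [Fintype.linearIndependent_iff]
  intro c hc
  set p : Polynomial ℂ := ∑ i : Fin (n + 1), Polynomial.C (c i) * Polynomial.X ^ (i : ℕ) with hp
  have heval : ∀ z, ∑ i : Fin (n + 1), c i * soninFun n i z =
      p.eval z * (weight n z * cosDiff z) := by
    intro z
    rw [hp, Polynomial.eval_finsetSum, Finset.sum_mul]
    refine Finset.sum_congr rfl fun i _ => ?_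
    simp only [Polynomial.eval_mul, Polynomial.eval_C, Polynomial.eval_pow, Polynomial.eval_X,
      soninFun]
    ring
  set g : ℂ → ℂ := fun z => ∑ i : Fin (n + 1), c i * soninFun n i z with hg
  have hgd : Differentiable ℂ g :=
    Differentiable.fun_sum fun i _ => (differentiable_soninFun n i).const_mul _
  have hae : (fun s => g (crit s)) =ᵐ[volume] fun _ => (0 : ℂ) := by
    have h1 : (∑ i : Fin (n + 1),
        c i • (memLp_soninFun (Nat.lt_succ_iff.1 i.2)).toLp (fun s => soninFun n i (crit s)) : L2) =
          0 := by
      have := congrArg Subtype.val hc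
      simpa using this
    have h2 := Lp.coeFn_zero ℂ 2 (volume : Measure ℝ)
    rw [← h1] at h2
    have h3 : ∀ᵐ s : ℝ, ∀ i : Fin (n + 1),
        (c i • (memLp_soninFun (Nat.lt_succ_iff.1 i.2)).toLp (fun s => soninFun n i (crit s)) : L2) s
          = c i * soninFun n i (crit s) := by
      rw [ae_all_iff]
      intro i
      filter_upwards [Lp.coeFn_smul (c i) ((memLp_soninFun (Nat.lt_succ_iff.1 i.2)).toLp
        (fun s => soninFun n i (crit s))),
        (memLp_soninFun (Nat.lt_succ_iff.1 i.2)).coeFn_toLp] with s hs hs'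
      rw [hs, Pi.smul_apply, hs', smul_eq_mul]
    filter_upwards [h2, h3, Lp.coeFn_finsetSum Finset.univ fun i : Fin (n + 1) =>
      (c i • (memLp_soninFun (Nat.lt_succ_iff.1 i.2)).toLp (fun s => soninFun n i (crit s)) : L2)]
      with s hs hs' hs''
    rw [hs''] at hs
    simp only [Finset.sum_apply, hs'] at hs
    exact hs
  have hzero : g = 0 := eq_zero_of_crit hgd fun s => congrFun
    (((hgd.continuous.comp continuous_crit).ae_eq_iff_eq volume continuous_const).1 hae) s
  obtain ⟨z, hz⟩ := exists_weight_mul_cosDiff_ne_zero n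
  have hcont : Continuous fun z => weight n z * cosDiff z :=
    (differentiable_weight n).continuous.mul differentiable_cosDiff.continuous
  have hp0 : p = 0 := by
    refine Polynomial.eq_zero_of_infinite_isRoot p
      (infinite_of_mem_nhds z ?_)
    filter_upwards [hcont.continuousAt.eventually_ne hz] with w hw
    have := heval w
    rw [show ∑ i : Fin (n + 1), c i * soninFun n i w = 0 from congrFun hzero w] at this
    exact (mul_eq_zero.1 this.symm).resolve_right hw
  intro i
  have := congrArg (fun q => Polynomial.coeff q i) hp0
  simpa [hp, Polynomial.finsetSum_coeff, Polynomial.coeff_X_pow, Fin.val_inj] using this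

theorem not_finiteDimensional_sonin (F : FinPlaces) :
    ¬ FiniteDimensional ℂ (sonin (uF F.1)) := by
  intro hF
  have hle : (⟨{none}, Finset.mem_singleton_self _⟩ : FinPlaces) ≤ F :=
    Finset.singleton_subset_iff.2 F.2
  have hfin : FiniteDimensional ℂ (sonin (uF {none})) :=
    FiniteDimensional.of_injective _ (soninMap_injective _ F hle)
  -- Taking `n` equal to the supposed dimension yields `n + 1` independent vectors.
  have h := (linearIndependent_soninFun
    (Module.finrank ℂ (sonin (uF {none})))).fintype_card_le_finrank
  rw [Fintype.card_fin] at h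
  omega

end SemilocalSonin

end

theorem mainTheorem2 :
    (∀ F : FinPlaces, ¬ FiniteDimensional ℂ (sonin (uF F.1))) ∧
    (∃ T : ∀ F F' : FinPlaces, F ≤ F' → (sonin (uF F.1) →ₗ[ℂ] sonin (uF F'.1)),
      (∀ (F F' : FinPlaces) (h : F ≤ F') (ξ : sonin (uF F.1)),
        (((T F F' h ξ : L2) : ℝ → ℂ) =ᵐ[volume]
          fun s : ℝ => dProd F.1 F'.1 (crit s) * (ξ : L2) s)) ∧
      (∀ (F F' : FinPlaces) (h : F ≤ F'), Function.Injective (T F F' h)) ∧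
      DirectedSystem (fun F : FinPlaces => sonin (uF F.1)) (fun F F' h => T F F' h)) ∧
    IsDirectedOrder FinPlaces :=
  ⟨not_finiteDimensional_sonin, ⟨soninMap, soninMap_apply, soninMap_injective,
    directedSystem_soninMap⟩, isDirectedOrder_finPlaces⟩
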